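/- Let $K$ be a field of characteristic $0$, $\Gamma$ a finite abelian group, $H=K[\Gamma]$, and let $W=\bigoplus_{i=1}^{\theta}Kx_i$ be a quantum linear space over $\Gamma$: $x_i$ has degree $g_i\in\Gamma$ and $\Gamma$ acts on it through a character $\chi_i:\Gamma\to K^\times$, where $\chi_i(g_j)\chi_j(g_i)=1$ for $i\ne j$, and $\chi_i(g_i)$ is a primitive $r_i$-th root of unity, $r_i\ge 2$. Let $R=\mathcal B(W)$ be the Nichols algebra of $W$ and $A=R\# H$ its Radford biproduct, so that $hx_i=\chi_i(h)x_ih$ and $\Delta(h)=h\otimes h$ for $h\in\Gamma$, and $\Delta(x_i)=x_i\otimes 1+g_i\otimes x_i$. Let $\pi:A\to H$ be the projection with $\pi(h)=h$, $\pi(x_i)=0$, and let $\lambda:H\to K$ be the total integral, $\lambda(h)=\delta_{h,1}$ for $h\in\Gamma$. For $i\in\{1,\dots,\theta\}$ and $a_i\in K$ with $\chi_i^{r_i}=\varepsilon$, let $\gamma_i:A\otimes A\to K$ be the linear map determined as follows. It is $H$-bilinear, $\gamma_i(hy\otimes zh')=\varepsilon(h)\,\gamma_i(y\otimes z)\,\varepsilon(h')$,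 and $H$-balanced, $\gamma_i(yh\otimes z)=\gamma_i(y\otimes hz)$, for $h,h'\in H$ and $y,z\in A$; and on pairs of monomials $x_1^{n_1}\cdots x_\theta^{n_\theta}\otimes x_1^{m_1}\cdots x_\theta^{m_\theta}$ with $0\le n_j,m_j<r_j$ it equals $\varepsilon\otimes\varepsilon$, except that $\gamma_i(x_i^{k}\otimes x_i^{r_i-k})=a_i$ for $0<k<r_i$. Let $I\subseteq\{1,\dots,\theta\}$, let $a_i\in K$ be such that $\chi_i^{r_i}=\varepsilon$ and $\gamma_i\neq\varepsilon\otimes\varepsilon$ for all $i\in I$, and let $\alpha=\prod_{i\in I}\gamma_i$ be the convolution product, taken in increasing order of the indices. Suppose that $g_{j_1}^{r_{j_1}}\cdots g_{j_t}^{r_{j_t}}\ne 1$ for every nonempty subset $\{j_1,\dots,j_t\}$ of $I$ (with $j_1,\dots,j_t$ distinct). Then the maps $\gamma_i$, $i\in I$, exist, $\alpha$ is convolution invertible, and for the multiplication $m_B=\alpha * m_A * \alpha^{-1}$ of the twist $B=A^{\alpha}$ one has $$\lambda\circ\pi\circ m_B=\alpha_R\quad\text{on } R\otimes R,$$ where $\alpha_R$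 is the restriction of $\alpha$ to $R\otimes R$. -/

import Mathlib

open scoped TensorProduct

noncomputable section

/-- A quantum linear space `W = ⊕ K x_i` over a group `Γ`: the vector `x_i` has degree `g i` and
`Γ` acts on it through the character `χ i`; distinct `i, j` satisfy `χ_i(g_j) χ_j(g_i) = 1`, and
`χ_i(g_i)` is a primitive `r_i`-th root of unity, `r_i ≥ 2`. -/
structure QuantumLinearSpace (K : Type*) [Field K] (Γ : Type*) [CommGroup Γ] (θ : ℕ) where
  g : Fin θ → Γ
  χ : Fin θ → Γ →* Kˣ
  r : Fin θ → ℕ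
  braiding : ∀ i j, i ≠ j → χ i (g j) * χ j (g i) = 1
  two_le : ∀ i, 2 ≤ r i
  primitive : ∀ i, IsPrimitiveRoot (χ i (g i)) (r i)

namespace QuantumLinearSpace

variable {K : Type*} [Field K] {Γ : Type*} [CommGroup Γ] {θ : ℕ} (W : QuantumLinearSpace K Γ θ)

/-! ### The bosonization `T(W) # K[Γ]` of the tensor algebra -/

/-- The relations of the smash product `T(W) # K[Γ]` between the generators `h ∈ Γ` and
`x_1, …, x_θ`: those of the group `Γ`, and `h x_i = χ_i(h) x_i h`. -/
inductive Rel : FreeAlgebra K (Γ ⊕ Fin θ) → FreeAlgebra K (Γ ⊕ Fin θ) → Prop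
  | one : Rel (FreeAlgebra.ι K (Sum.inl 1)) 1
  | mul (h k : Γ) : Rel (FreeAlgebra.ι K (Sum.inl h) * FreeAlgebra.ι K (Sum.inl k))
      (FreeAlgebra.ι K (Sum.inl (h * k)))
  | comm (h : Γ) (i : Fin θ) : Rel (FreeAlgebra.ι K (Sum.inl h) * FreeAlgebra.ι K (Sum.inr i))
      ((W.χ i h : K) • (FreeAlgebra.ι K (Sum.inr i) * FreeAlgebra.ι K (Sum.inl h)))

/-- The algebra `T(W) # K[Γ]`. -/
abbrev TensorBoson : Type _ := RingQuot W.Rel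

/-- The element `h ∈ Γ` of `T(W) # K[Γ]`. -/
def tGrp (h : Γ) : W.TensorBoson := RingQuot.mkAlgHom K W.Rel (FreeAlgebra.ι K (Sum.inl h))

/-- The element `x_i` of `T(W) # K[Γ]`. -/
def tX (i : Fin θ) : W.TensorBoson := RingQuot.mkAlgHom K W.Rel (FreeAlgebra.ι K (Sum.inr i))

theorem tGrp_one : W.tGrp 1 = 1 := by
  simpa [tGrp] using RingQuot.mkAlgHom_rel K (Rel.one (W := W))

theorem tGrp_mul (h k : Γ) : W.tGrp (h * k) = W.tGrp h * W.tGrp k := by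
  simpa [tGrp] using (RingQuot.mkAlgHom_rel K (Rel.mul (W := W) h k)).symm

theorem tGrp_mul_tX (h : Γ) (i : Fin θ) :
    W.tGrp h * W.tX i = (W.χ i h : K) • (W.tX i * W.tGrp h) := by
  simpa [tGrp, tX] using RingQuot.mkAlgHom_rel K (Rel.comm (W := W) h i)

/-- An algebra homomorphism out of `T(W) # K[Γ]`, given on the generators. -/
def tLift {B : Type*} [Semiring B] [Algebra K B] (G : Γ → B) (X : Fin θ → B) (h1 : G 1 = 1)
    (hm : ∀ h k, G h * G k = G (h * k))
    (hc : ∀ h i, G h * X i = (W.χ i h : K) • (X i * G h)) : W.TensorBoson →ₐ[K] B :=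
  RingQuot.liftAlgHom K ⟨FreeAlgebra.lift K (Sum.elim G X), by
    intro a b hab
    cases hab with
    | one => simpa using h1
    | mul h k => simpa using hm h k
    | comm h i => simpa using hc h i⟩

section lift
variable {B : Type*} [Semiring B] [Algebra K B] (G : Γ → B) (X : Fin θ → B) (h1 : G 1 = 1)
    (hm : ∀ h k, G h * G k = G (h * k))
    (hc : ∀ h i, G h * X i = (W.χ i h : K) • (X i * G h))

@[simp] theorem tLift_tGrp (h : Γ) : W.tLift G X h1 hm hc (W.tGrp h) = G h := by
  simp [tLift, tGrp]

@[simp] theorem tLift_tX (i : Fin θ) : W.tLift G X h1 hm hc (W.tX i) = X i := by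
  simp [tLift, tX]

end lift

theorem tHom_ext {B : Type*} [Semiring B] [Algebra K B] {f f' : W.TensorBoson →ₐ[K] B}
    (hG : ∀ h, f (W.tGrp h) = f' (W.tGrp h)) (hX : ∀ i, f (W.tX i) = f' (W.tX i)) : f = f' := by
  apply RingQuot.ringQuot_ext'
  apply FreeAlgebra.hom_ext
  funext s
  rcases s with h | i
  · exact hG h
  · exact hX i

theorem tComul_aux_one : W.tGrp 1 ⊗ₜ[K] W.tGrp 1 = 1 := by
  rw [tGrp_one, Algebra.TensorProduct.one_def]

theorem tComul_aux_mul (h k : Γ) :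
    (W.tGrp h ⊗ₜ[K] W.tGrp h) * (W.tGrp k ⊗ₜ[K] W.tGrp k) =
      W.tGrp (h * k) ⊗ₜ[K] W.tGrp (h * k) := by
  rw [Algebra.TensorProduct.tmul_mul_tmul, tGrp_mul]

theorem tComul_aux_comm (h : Γ) (i : Fin θ) :
    (W.tGrp h ⊗ₜ[K] W.tGrp h) * (W.tX i ⊗ₜ[K] 1 + W.tGrp (W.g i) ⊗ₜ[K] W.tX i) =
      (W.χ i h : K) •
        ((W.tX i ⊗ₜ[K] 1 + W.tGrp (W.g i) ⊗ₜ[K] W.tX i) * (W.tGrp h ⊗ₜ[K] W.tGrp h)) := by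
  have hcomm : W.tGrp h * W.tGrp (W.g i) = W.tGrp (W.g i) * W.tGrp h := by
    rw [← tGrp_mul, ← tGrp_mul, mul_comm]
  simp only [mul_add, add_mul, Algebra.TensorProduct.tmul_mul_tmul, tGrp_mul_tX, hcomm,
    mul_one, one_mul, smul_add, TensorProduct.smul_tmul', TensorProduct.tmul_smul]

/-- The comultiplication of `T(W) # K[Γ]`: `Δ(h) = h ⊗ h` and `Δ(x_i) = x_i ⊗ 1 + g_i ⊗ x_i`. -/
def tComul : W.TensorBoson →ₐ[K] W.TensorBoson ⊗[K] W.TensorBoson :=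
  W.tLift (fun h => W.tGrp h ⊗ₜ[K] W.tGrp h)
    (fun i => W.tX i ⊗ₜ[K] 1 + W.tGrp (W.g i) ⊗ₜ[K] W.tX i)
    W.tComul_aux_one W.tComul_aux_mul W.tComul_aux_comm

/-- The counit of `T(W) # K[Γ]`: `ε(h) = 1` and `ε(x_i) = 0`. -/
def tCounit : W.TensorBoson →ₐ[K] K :=
  W.tLift (fun _ => 1) (fun _ => 0) rfl (by simp) (by simp)

theorem tComul_tGrp (h : Γ) : W.tComul (W.tGrp h) = W.tGrp h ⊗ₜ[K] W.tGrp h :=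
  W.tLift_tGrp _ _ W.tComul_aux_one W.tComul_aux_mul W.tComul_aux_comm h

theorem tComul_tX (i : Fin θ) :
    W.tComul (W.tX i) = W.tX i ⊗ₜ[K] 1 + W.tGrp (W.g i) ⊗ₜ[K] W.tX i :=
  W.tLift_tX _ _ W.tComul_aux_one W.tComul_aux_mul W.tComul_aux_comm i

theorem tCounit_tGrp (h : Γ) : W.tCounit (W.tGrp h) = 1 := by rw [tCounit, tLift_tGrp]

theorem tCounit_tX (i : Fin θ) : W.tCounit (W.tX i) = 0 := by rw [tCounit, tLift_tX]

instance : Bialgebra K W.TensorBoson :=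
  Bialgebra.ofAlgHom W.tComul W.tCounit
    (by
      apply W.tHom_ext
      · intro h; simp [tComul_tGrp]
      · intro i
        simp [tComul_tX, tComul_tGrp, TensorProduct.add_tmul, TensorProduct.tmul_add,
          Algebra.TensorProduct.one_def, add_assoc])
    (by
      apply W.tHom_ext
      · intro h; simp [tComul_tGrp, tCounit_tGrp]
      · intro i; simp [tComul_tX, tCounit_tX, tCounit_tGrp])
    (by
      apply W.tHom_ext
      · intro h; simp [tComul_tGrp, tCounit_tGrp]
      · intro i; simp [tComul_tX, tCounit_tX])

/-- The projection `T(W) # K[Γ] → K[Γ]`, `h ↦ h`, `x_i ↦ 0`. -/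
def tProj : W.TensorBoson →ₐ[K] MonoidAlgebra K Γ :=
  W.tLift (fun h => MonoidAlgebra.of K Γ h) (fun _ => 0) (map_one _)
    (by intro h k; exact (map_mul _ h k).symm) (by simp)

/-! ### The Nichols algebra `R = 𝓑(W)` and its Radford biproduct `A = R # K[Γ]` -/

/-- A biideal of `T(W) # K[Γ]` (two-sided ideal and coideal) all of whose elements have degree at
least two in the `x_i`; the kernel of the projection to `K[Γ]` is the part of degree at least one,
so its square is the part of degree at least two. -/
def IsNicholsBiideal (I : Ideal W.TensorBoson) : Prop :=
  I.IsTwoSided ∧ (I.restrictScalars K).IsCoideal ∧ I ≤ RingHom.ker W.tProj ^ 2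

/-- The largest biideal of `T(W) # K[Γ]` that is contained in the part of degree at least two. -/
def nicholsIdeal : Ideal W.TensorBoson := sSup {I | W.IsNicholsBiideal I}

instance : W.nicholsIdeal.IsTwoSided := by
  constructor
  intro a b ha
  have hle : W.nicholsIdeal ≤
      Submodule.comap (LinearMap.toSpanSingleton W.TensorBoson W.TensorBoson b)
        W.nicholsIdeal := by
    refine sSup_le fun I hI x hx => ?_
    have := hI.1
    exact le_sSup (a := I) hI (I.mul_mem_right b hx)
  exact hle ha

instance : (W.nicholsIdeal.restrictScalars K).IsCoideal where
  counit_eq_zero := by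
    have hle : W.nicholsIdeal ≤ RingHom.ker (Bialgebra.counitAlgHom K W.TensorBoson) :=
      sSup_le fun I hI x hx => hI.2.1.counit_eq_zero hx
    exact fun x hx => hle hx
  map_mkQ_comul_eq_zero := by
    have hle : W.nicholsIdeal ≤ RingHom.ker ((Algebra.TensorProduct.map
        (Ideal.Quotient.mkₐ K W.nicholsIdeal) (Ideal.Quotient.mkₐ K W.nicholsIdeal)).comp
        (Bialgebra.comulAlgHom K W.TensorBoson)) := by
      refine sSup_le fun I hI x hx => ?_
      have h0 := hI.2.1.map_mkQ_comul_eq_zero hx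
      have hIJ : I.restrictScalars K ≤ W.nicholsIdeal.restrictScalars K :=
        fun y hy => le_sSup (a := I) hI hy
      have h1 := congrArg (TensorProduct.map (Submodule.factor hIJ) (Submodule.factor hIJ)) h0
      rw [← LinearMap.comp_apply, ← TensorProduct.map_comp, map_zero] at h1
      exact h1
    exact fun x hx => hle hx

/-- The Radford biproduct `A = 𝓑(W) # K[Γ]` of the Nichols algebra of `W` with `K[Γ]`: the quotient
of `T(W) # K[Γ]` by its largest biideal contained in degrees at least two. It is a bialgebra. -/
abbrev A : Type _ := W.TensorBoson ⧸ W.nicholsIdeal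

/-- The element `x_i` of `A`. -/
def x (i : Fin θ) : W.A := Ideal.Quotient.mk W.nicholsIdeal (W.tX i)

/-- The inclusion of `H = K[Γ]` into `A`. -/
def incl : MonoidAlgebra K Γ →ₐ[K] W.A :=
  MonoidAlgebra.lift K W.A Γ
    { toFun := fun h => Ideal.Quotient.mk W.nicholsIdeal (W.tGrp h)
      map_one' := by rw [tGrp_one, map_one]
      map_mul' := fun h k => by rw [tGrp_mul, map_mul] }

theorem nicholsIdeal_le_ker_tProj : W.nicholsIdeal ≤ RingHom.ker W.tProj :=
  sSup_le fun _ hI => hI.2.2.trans (Ideal.pow_le_self two_ne_zero)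

/-- The projection `π : A → H = K[Γ]`, `h ↦ h`, `x_i ↦ 0`, that is, `ε_R ⊗ id_H`. -/
def proj : W.A →ₐ[K] MonoidAlgebra K Γ :=
  Ideal.Quotient.liftₐ W.nicholsIdeal W.tProj fun _ ha => W.nicholsIdeal_le_ker_tProj ha

/-- The Nichols algebra `R = 𝓑(W)` inside `A = R # H`: the subalgebra generated by `W`. -/
def nichols : Subalgebra K W.A := Algebra.adjoin K (Set.range W.x)

/-- The inclusion `R ⊗ R → A ⊗ A`. -/
def nicholsIncl : W.nichols ⊗[K] W.nichols →ₗ[K] W.A ⊗[K] W.A :=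
  TensorProduct.map W.nichols.val.toLinearMap W.nichols.val.toLinearMap

/-- The monomial `x_1 ^ n_1 ⋯ x_θ ^ n_θ` of `A`. -/
def mono (n : Fin θ → ℕ) : W.A := (List.ofFn fun i => W.x i ^ n i).prod

/-- The total integral `λ` on `K[Γ]`: `λ(h) = δ_{h,1}` for `h ∈ Γ`. -/
def integral (K Γ : Type*) [Field K] [CommGroup Γ] : MonoidAlgebra K Γ →ₗ[K] K :=
  Finsupp.lapply 1 ∘ₗ (MonoidAlgebra.coeffLinearEquiv K).toLinearMap

/-! ### The maps `γ_i`, and the twist of the multiplication of `A`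

Linear maps `A ⊗ A → K` and `A ⊗ A → A` are multiplied by convolution, in `WithConv _`. -/

/-- `γ : A ⊗ A → K` is the map `γ_i` with parameter `a`: it is `H`-bilinear and `H`-balanced, and on
pairs of monomials `x_1 ^ n_1 ⋯ x_θ ^ n_θ`, `n_j < r_j`, it agrees with `ε ⊗ ε` except that
`γ(x_i ^ k ⊗ x_i ^ (r_i - k)) = a` for `0 < k < r_i`. -/
structure IsGamma (i : Fin θ) (a : K) (γ : W.A ⊗[K] W.A →ₗ[K] K) : Prop where
  left : ∀ (h : MonoidAlgebra K Γ) (y z : W.A),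
    γ ((W.incl h * y) ⊗ₜ z) = Coalgebra.counit (R := K) h * γ (y ⊗ₜ z)
  right : ∀ (h : MonoidAlgebra K Γ) (y z : W.A),
    γ (y ⊗ₜ (z * W.incl h)) = γ (y ⊗ₜ z) * Coalgebra.counit (R := K) h
  balanced : ∀ (h : MonoidAlgebra K Γ) (y z : W.A),
    γ ((y * W.incl h) ⊗ₜ z) = γ (y ⊗ₜ (W.incl h * z))
  exceptional : ∀ k, 0 < k → k < W.r i → γ ((W.x i ^ k) ⊗ₜ (W.x i ^ (W.r i - k))) = a
  trivial : ∀ n m : Fin θ → ℕ, (∀ j, n j < W.r j) → (∀ j, m j < W.r j) →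
    (¬ ∃ k, 0 < k ∧ k < W.r i ∧ n = Pi.single i k ∧ m = Pi.single i (W.r i - k)) →
    γ (W.mono n ⊗ₜ W.mono m) =
      Coalgebra.counit (R := K) (W.mono n) * Coalgebra.counit (R := K) (W.mono m)

open Classical in
/-- The map `γ_i : A ⊗ A → K` with parameter `a`. It is determined by the conditions `IsGamma`, since
the `x_1 ^ n_1 ⋯ x_θ ^ n_θ h`, with `n_j < r_j` and `h ∈ Γ`, span `A`; it is `0` by convention if
no map satisfies them. -/
def gamma (i : Fin θ) (a : K) : WithConv (W.A ⊗[K] W.A →ₗ[K] K) :=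
  if h : ∃ γ, W.IsGamma i a γ then WithConv.toConv h.choose else 0

/-- The convolution product `α = ∏_{i ∈ I} γ_i`, in increasing order of the indices, where `γ_i` has
parameter `a_i`. -/
def alpha (a : Fin θ → K) (I : Finset (Fin θ)) : WithConv (W.A ⊗[K] W.A →ₗ[K] K) :=
  ((I.sort (· ≤ ·)).map fun i => W.gamma i (a i)).prod

/-- The multiplication `m_B = α * m_A * α⁻¹` (convolution products in `Hom(A ⊗ A, A)`) of the twist
`B = A^α` of `A`, on the same underlying coalgebra as `A`. -/
def twistedMul (α : WithConv (W.A ⊗[K] W.A →ₗ[K] K)) : W.A ⊗[K] W.A →ₗ[K] W.A :=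
  (WithConv.toConv (Algebra.linearMap K W.A ∘ₗ α.ofConv) *
    WithConv.toConv (LinearMap.mul' K W.A) *
    WithConv.toConv (Algebra.linearMap K W.A ∘ₗ (Ring.inverse α).ofConv)).ofConv

end QuantumLinearSpace

end

/-!
Every `x_i ^ r_i` and every `x_i x_j - χ_j(g_i) x_j x_i`, `i ≠ j`, generates a biideal inside the
part of degree at least two, so these elements vanish in `A`; hence the products of reduced
monomials and elements of `Γ` span `A`, and `γ_i` is unique.

Let `χ_i : A → K` be the character extended by `χ_i(x_j) = 0`, and let `∂_i : A → K` be the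
`(χ_i, ε)`-derivation with `∂_i(h) = 0` and `∂_i(x_j) = δ_{ij}`. In the convolution algebra
`χ_i * ∂_i = q ∂_i * χ_i`, where `q = χ_i(g_i)`, and `∂_i ^ r_i = 0`. Formally
`(∂_i ⊗ ε + χ_i ⊗ ∂_i) ^ r_i / (r_i)_q!` is a form on `A ⊗ A`; although its denominator vanishes,
the terms of its `q`-binomial expansion other than the two outer ones make sense. Their sum `η_i`
has square zero, and `γ_i = 1 + a_i η_i`. So `γ_i⁻¹ = 1 - a_i η_i`.

Let `P = π ∘ m_A`. Then `P * η_i = g_i ^ r_i (η_i * P)`, so `α⁻¹ - 1` is a sum of forms `φ` with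
`P * φ = k (φ * P)`, where `k = ∏_{j ∈ J} g_j ^ r_j` and `∅ ≠ J ⊆ I`. On `R ⊗ R`, which is
coinvariant for `π`, one has `ψ * P = ψ`; therefore `λ` sends `α * P * φ` to `λ(k) (α * φ) = 0`, and
of `α * P * α⁻¹` only `α * P` survives, which gives `α_R`.
-/

noncomputable section

/-! ### Quantum binomial coefficients -/

section QuantumIntegers

variable {R : Type*} [CommRing R]

/-- The quantum integer `(n)_q = 1 + q + ⋯ + q ^ (n - 1)`. -/
def qInt (q : R) (n : ℕ) : R := ∑ i ∈ Finset.range n, q ^ i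

/-- The quantum factorial `(n)_q! = (1)_q (2)_q ⋯ (n)_q`. -/
def qFactorial (q : R) (n : ℕ) : R := ∏ i ∈ Finset.range n, qInt q (i + 1)

/-- The quantum binomial coefficient `(k + l)_q! / ((k)_q! (l)_q!)`. It is indexed by `k` and `l`
(not by `k + l` and `k`), and defined by Pascal's rule, so that it makes sense at roots of unity. -/
def qBinom (q : R) : ℕ → ℕ → R
  | 0, _ => 1
  | _ + 1, 0 => 1
  | k + 1, l + 1 => qBinom q k (l + 1) + q ^ (k + 1) * qBinom q (k + 1) l

theorem qInt_succ (q : R) (n : ℕ) : qInt q (n + 1) = q * qInt q n + 1 := by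
  simp only [qInt, Finset.sum_range_succ', pow_succ', pow_zero, Finset.mul_sum]

theorem qInt_add (q : R) (m n : ℕ) : qInt q (m + n) = qInt q m + q ^ m * qInt q n := by
  simp only [qInt, Finset.sum_range_add, pow_add, Finset.mul_sum]

theorem qFactorial_zero (q : R) : qFactorial q 0 = 1 := Finset.prod_range_zero _

theorem qFactorial_succ (q : R) (n : ℕ) :
    qFactorial q (n + 1) = qFactorial q n * qInt q (n + 1) :=
  Finset.prod_range_succ _ n

theorem qBinom_zero_left (q : R) (l : ℕ) : qBinom q 0 l = 1 := by rw [qBinom]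

theorem qBinom_zero_right (q : R) (k : ℕ) : qBinom q k 0 = 1 := by cases k <;> rw [qBinom]

theorem qBinom_succ_succ (q : R) (k l : ℕ) :
    qBinom q (k + 1) (l + 1) = qBinom q k (l + 1) + q ^ (k + 1) * qBinom q (k + 1) l := by
  rw [qBinom]

theorem qBinom_mul_qFactorial (q : R) (k l : ℕ) :
    qBinom q k l * (qFactorial q k * qFactorial q l) = qFactorial q (k + l) := by
  induction k generalizing l with
  | zero => simp only [qBinom_zero_left, qFactorial_zero, one_mul, zero_add]
  | succ k ihk =>
    induction l with
    | zero => simp only [qBinom_zero_right, qFactorial_zero, one_mul, mul_one, add_zero]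
    | succ l ihl =>
      have ihk' := ihk (l + 1)
      have hsplit : qFactorial q (k + 1 + (l + 1)) =
          qFactorial q (k + (l + 1)) * (qInt q (k + 1) + q ^ (k + 1) * qInt q (l + 1)) := by
        rw [← qInt_add, show k + 1 + (l + 1) = (k + (l + 1)) + 1 by ring, qFactorial_succ]
      rw [show k + 1 + l = k + (l + 1) by ring] at ihl
      rw [hsplit, qBinom_succ_succ]
      rw [qFactorial_succ q k] at ihl ⊢
      rw [qFactorial_succ q l] at ihk' ⊢
      linear_combination (q ^ (k + 1) * qInt q (l + 1)) * ihl + qInt q (k + 1) * ihk'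

theorem sum_antidiagonal_succ_qBinom_smul {M : Type*} [AddCommMonoid M] [Module R M] (q : R)
    (f : ℕ → ℕ → M) (n : ℕ) :
    ∑ p ∈ Finset.HasAntidiagonal.antidiagonal (n + 1), qBinom q p.1 p.2 • f p.1 p.2 =
      ∑ p ∈ Finset.HasAntidiagonal.antidiagonal n, qBinom q p.1 p.2 • f (p.1 + 1) p.2 +
        ∑ p ∈ Finset.HasAntidiagonal.antidiagonal n,
          (q ^ p.1 * qBinom q p.1 p.2) • f p.1 (p.2 + 1) := by
  let F : ℕ × ℕ → M := fun
    | (0, _) => 0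
    | (k + 1, l) => qBinom q k l • f (k + 1) l
  let G : ℕ × ℕ → M := fun
    | (_, 0) => 0
    | (k, l + 1) => (q ^ k * qBinom q k l) • f k (l + 1)
  have pascal : ∀ p ∈ Finset.HasAntidiagonal.antidiagonal (n + 1),
      qBinom q p.1 p.2 • f p.1 p.2 = F p + G p := by
    rintro ⟨_ | k, _ | l⟩ hp
    · simp at hp
    · simp [F, G, qBinom_zero_left]
    · simp [F, G, qBinom_zero_right]
    · simp [F, G, qBinom_succ_succ, add_smul]
  rw [Finset.sum_congr rfl pascal, Finset.sum_add_distrib, Finset.Nat.sum_antidiagonal_succ,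
    Finset.Nat.sum_antidiagonal_succ' (f := G)]
  simp only [F, G, zero_add]

theorem qInt_ne_zero {q : R} {r n : ℕ} (hq : IsPrimitiveRoot q r) (h0 : n ≠ 0) (hn : n < r) :
    qInt q n ≠ 0 := by
  intro h
  have hpow := mul_geom_sum q n
  rw [← qInt, h, mul_zero] at hpow
  exact hq.pow_ne_one_of_pos_of_lt h0 hn (sub_eq_zero.1 hpow.symm)

variable [IsDomain R] {q : R} {r : ℕ}

theorem qInt_eq_zero (hq : IsPrimitiveRoot q r) (hr : 1 < r) : qInt q r = 0 :=
  hq.geom_sum_eq_zero hr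

theorem qFactorial_ne_zero (hq : IsPrimitiveRoot q r) {n : ℕ} (hn : n < r) :
    qFactorial q n ≠ 0 :=
  Finset.prod_ne_zero_iff.2 fun i hi =>
    qInt_ne_zero hq i.succ_ne_zero ((Nat.succ_le_of_lt (Finset.mem_range.1 hi)).trans_lt hn)

theorem qFactorial_eq_zero (hq : IsPrimitiveRoot q r) (hr : 1 < r) : qFactorial q r = 0 := by
  obtain ⟨n, rfl⟩ := Nat.exists_eq_add_one_of_ne_zero (Nat.ne_zero_of_lt hr)
  rw [qFactorial_succ, qInt_eq_zero hq hr, mul_zero]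

theorem qBinom_eq_zero (hq : IsPrimitiveRoot q r) {k l : ℕ} (hkl : k + l = r) (hk : k ≠ 0)
    (hl : l ≠ 0) : qBinom q k l = 0 := by
  have h := qBinom_mul_qFactorial q k l
  rw [hkl, qFactorial_eq_zero hq (by omega)] at h
  exact (mul_eq_zero.1 h).resolve_right
    (mul_ne_zero (qFactorial_ne_zero hq (by omega)) (qFactorial_ne_zero hq (by omega)))

end QuantumIntegers

/-! ### `q`-commuting elements -/

/-- The elements `a` and `b` of an algebra `q`-commute: `a b = q b a`. -/
def QCommute {R B : Type*} [CommSemiring R] [Semiring B] [Algebra R B] (q : R) (a b : B) : Prop :=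
  a * b = q • (b * a)

namespace QCommute

variable {R B : Type*} [CommSemiring R] [Semiring B] [Algebra R B] {p q : R} {a b c : B}

theorem one_right (a : B) : QCommute (1 : R) a 1 := by
  rw [QCommute, mul_one, one_mul, one_smul]

theorem mul_right (hb : QCommute p a b) (hc : QCommute q a c) : QCommute (p * q) a (b * c) := by
  rw [QCommute, ← mul_assoc, hb, smul_mul_assoc, mul_assoc, hc, mul_smul_comm, smul_smul,
    mul_assoc]

theorem pow_right (h : QCommute q a b) (n : ℕ) : QCommute (q ^ n) a (b ^ n) := by
  induction n with
  | zero => simpa only [pow_zero] using one_right a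
  | succ n ih => simpa only [pow_succ] using ih.mul_right h

theorem one_left (b : B) : QCommute (1 : R) 1 b := by
  rw [QCommute, mul_one, one_mul, one_smul]

theorem mul_left (ha : QCommute p a c) (hb : QCommute q b c) : QCommute (p * q) (a * b) c := by
  rw [QCommute, mul_assoc, hb, mul_smul_comm, ← mul_assoc, ha, smul_mul_assoc, smul_smul,
    mul_assoc, mul_comm]

theorem pow_left (h : QCommute q a b) (n : ℕ) : QCommute (q ^ n) (a ^ n) b := by
  induction n with
  | zero => simpa only [pow_zero] using one_left b
  | succ n ih => simpa only [pow_succ] using ih.mul_left h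

theorem exists_list_prod_right {l : List B} (h : ∀ b ∈ l, ∃ q : R, QCommute q a b) :
    ∃ q : R, QCommute q a l.prod := by
  induction l with
  | nil => exact ⟨1, one_right a⟩
  | cons b l ih =>
    obtain ⟨p, hp⟩ := h b List.mem_cons_self
    obtain ⟨q, hq⟩ := ih fun c hc => h c (List.mem_cons_of_mem b hc)
    exact ⟨p * q, List.prod_cons (a := b) (l := l) ▸ hp.mul_right hq⟩

theorem add_pow {R : Type*} [CommRing R] [Algebra R B] {q : R} (h : QCommute q b a) (n : ℕ) :
    (a + b) ^ n = ∑ p ∈ Finset.HasAntidiagonal.antidiagonal n,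
      qBinom q p.1 p.2 • (a ^ p.1 * b ^ p.2) := by
  induction n with
  | zero => simp [qBinom_zero_left]
  | succ n ih =>
    rw [sum_antidiagonal_succ_qBinom_smul q (fun k l => a ^ k * b ^ l), pow_succ', ih, add_mul,
      Finset.mul_sum, Finset.mul_sum]
    congr 1
    · refine Finset.sum_congr rfl fun p _ => ?_
      rw [mul_smul_comm, ← mul_assoc, ← pow_succ']
    · refine Finset.sum_congr rfl fun p _ => ?_
      rw [mul_smul_comm, ← mul_assoc, h.pow_right p.1, smul_mul_assoc, smul_smul, mul_assoc,
        ← pow_succ', mul_comm]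

theorem add_pow_of_isPrimitiveRoot {R : Type*} [CommRing R] [IsDomain R] [Algebra R B] {q : R}
    (h : QCommute q b a) {r : ℕ} (hq : IsPrimitiveRoot q r) (hr : r ≠ 0) :
    (a + b) ^ r = a ^ r + b ^ r := by
  obtain ⟨n, rfl⟩ := Nat.exists_eq_add_one_of_ne_zero hr
  have middle : ∀ k ∈ Finset.range n,
      qBinom q (k + 1) (n - k) • (a ^ (k + 1) * b ^ (n - k)) = 0 := fun k hk => by
    have hkn := Finset.mem_range.1 hk
    rw [qBinom_eq_zero hq (by omega) k.succ_ne_zero (by omega), zero_smul]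
  rw [h.add_pow, Finset.Nat.sum_antidiagonal_eq_sum_range_succ_mk, Finset.sum_range_succ',
    Finset.sum_range_succ]
  simp only [Nat.add_sub_add_right, Finset.sum_eq_zero middle, qBinom_zero_left,
    qBinom_zero_right, Nat.sub_self, Nat.sub_zero, pow_zero, one_mul, mul_one, one_smul, zero_add]

end QCommute

section Reorder

variable {R B ι : Type*} [CommSemiring R] [Semiring B] [Algebra R B] [DecidableEq ι] {y : ι → B}

theorem exists_prod_map_pow_mul (hy : Pairwise fun i j => ∃ q : Rˣ, QCommute (q : R) (y i) (y j))
    (n : ι → ℕ) {l : List ι} (hl : l.Nodup) {j : ι} (hj : j ∈ l) :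
    ∃ c : Rˣ, (l.map fun i => y i ^ n i).prod * y j =
      (c : R) • (l.map fun i => y i ^ (n + Pi.single j 1 : ι → ℕ) i).prod := by
  induction l using List.reverseRecOn with
  | nil => exact absurd hj List.not_mem_nil
  | append_singleton l k ih =>
    obtain ⟨hkl, hl⟩ := List.nodup_cons.1 ((List.perm_append_singleton k l).nodup_iff.1 hl)
    simp only [List.map_append, List.map_singleton, List.prod_append, List.prod_singleton]
    obtain rfl | hjk := eq_or_ne j k
    · refine ⟨1, ?_⟩
      have hn : ∀ i ∈ l, y i ^ (n + Pi.single j 1 : ι → ℕ) i = y i ^ n i := fun i hi => by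
        rw [Pi.add_apply, Pi.single_eq_of_ne (ne_of_mem_of_not_mem hi hkl), add_zero]
      rw [List.map_congr_left hn, Pi.add_apply, Pi.single_eq_same, pow_succ, mul_assoc,
        Units.val_one, one_smul]
    · obtain ⟨q, hq⟩ := hy hjk.symm
      obtain ⟨c, hc⟩ := ih hl (by simpa [hjk] using hj)
      refine ⟨q ^ n k * c, ?_⟩
      rw [mul_assoc, hq.pow_left, mul_smul_comm, ← mul_assoc, hc, smul_mul_assoc, smul_smul,
        Pi.add_apply n _ k, Pi.single_eq_of_ne hjk.symm, add_zero, Units.val_mul,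
        Units.val_pow_eq_pow_val]

end Reorder

/-! ### Generation, coideals and relations -/

theorem adjoin_toSubmodule_le_of_mul_mem_right {R B : Type*} [CommSemiring R] [Semiring B]
    [Algebra R B] {s : Set B} {p : Submodule R B} (one : 1 ∈ p)
    (mul_right : ∀ y ∈ p, ∀ b ∈ s, y * b ∈ p) :
    Subalgebra.toSubmodule (Algebra.adjoin R s) ≤ p := by
  rw [Algebra.adjoin_eq_span, Submodule.span_le]
  intro y hy
  induction hy using Submonoid.closure_induction_right with
  | one => exact one
  | mul_right y _ b hb ih => exact mul_right y ih b hb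

theorem apply_eq_zero_of_mem_twoSidedIdeal_span {S T F : Type*} [Ring S] [Ring T]
    [FunLike F S T] [RingHomClass F S T] (f : F) {s y : S} (hs : f s = 0)
    (hy : y ∈ TwoSidedIdeal.span {s}) : f y = 0 :=
  (TwoSidedIdeal.mem_ker f).1 <| TwoSidedIdeal.span_le.2
    (Set.singleton_subset_iff.2 ((TwoSidedIdeal.mem_ker f).2 hs)) hy

theorem isCoideal_span_of_comul_eq {R B : Type*} [CommRing R] [Ring B] [Bialgebra R B]
    {s a b : B} (counit_eq_zero : Coalgebra.counit (R := R) s = 0)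
    (comul_eq : Coalgebra.comul (R := R) s = s ⊗ₜ a + b ⊗ₜ s) :
    ((TwoSidedIdeal.span {s}).asIdeal.restrictScalars R).IsCoideal := by
  let mk := Ideal.Quotient.mkₐ R (TwoSidedIdeal.span {s}).asIdeal
  have mk_s : mk s = 0 := Ideal.Quotient.eq_zero_iff_mem.2
    (TwoSidedIdeal.mem_asIdeal.2 (TwoSidedIdeal.subset_span rfl))
  have map_mk_comul_s :
      (Algebra.TensorProduct.map mk mk).comp (Bialgebra.comulAlgHom R B) s = 0 := by
    rw [AlgHom.comp_apply, Bialgebra.comulAlgHom_apply, comul_eq, map_add,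
      Algebra.TensorProduct.map_tmul, Algebra.TensorProduct.map_tmul, mk_s,
      TensorProduct.zero_tmul, TensorProduct.tmul_zero, add_zero]
  exact ⟨fun _ hy => apply_eq_zero_of_mem_twoSidedIdeal_span (Bialgebra.counitAlgHom R B)
      counit_eq_zero (TwoSidedIdeal.mem_asIdeal.1 hy),
    fun _ hy => apply_eq_zero_of_mem_twoSidedIdeal_span
      ((Algebra.TensorProduct.map mk mk).comp (Bialgebra.comulAlgHom R B)) map_mk_comul_s
      (TwoSidedIdeal.mem_asIdeal.1 hy)⟩

namespace QuantumLinearSpace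

variable {K : Type*} [Field K] {Γ : Type*} [CommGroup Γ] {θ : ℕ} (W : QuantumLinearSpace K Γ θ)

/-- The element `h ∈ Γ` of `A`. -/
def grp (h : Γ) : W.A := Ideal.Quotient.mk W.nicholsIdeal (W.tGrp h)

theorem incl_of (h : Γ) : W.incl (MonoidAlgebra.of K Γ h) = W.grp h := by
  rw [incl, MonoidAlgebra.lift_of]
  rfl

theorem grp_one : W.grp 1 = 1 := by rw [grp, tGrp_one, map_one]

theorem grp_mul (h k : Γ) : W.grp (h * k) = W.grp h * W.grp k := by
  rw [grp, tGrp_mul, map_mul]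
  rfl

theorem grp_mul_x (h : Γ) (i : Fin θ) : QCommute (W.χ i h : K) (W.grp h) (W.x i) :=
  congrArg (Ideal.Quotient.mkₐ K W.nicholsIdeal) (W.tGrp_mul_tX h i)

theorem comul_grp (h : Γ) : Coalgebra.comul (R := K) (W.grp h) = W.grp h ⊗ₜ W.grp h :=
  congrArg (TensorProduct.map (Ideal.Quotient.mkₐ K W.nicholsIdeal).toLinearMap
    (Ideal.Quotient.mkₐ K W.nicholsIdeal).toLinearMap) (W.tComul_tGrp h)

theorem counit_grp (h : Γ) : Coalgebra.counit (R := K) (W.grp h) = 1 := W.tCounit_tGrp h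

theorem isGroupLikeElem_grp (h : Γ) : IsGroupLikeElem K (W.grp h) :=
  ⟨W.counit_grp h, W.comul_grp h⟩

theorem comul_x (i : Fin θ) :
    Coalgebra.comul (R := K) (W.x i) = W.x i ⊗ₜ 1 + W.grp (W.g i) ⊗ₜ W.x i :=
  (congrArg (TensorProduct.map (Ideal.Quotient.mkₐ K W.nicholsIdeal).toLinearMap
    (Ideal.Quotient.mkₐ K W.nicholsIdeal).toLinearMap) (W.tComul_tX i)).trans (by
      rw [map_add]; rfl)

theorem counit_x (i : Fin θ) : Coalgebra.counit (R := K) (W.x i) = 0 := W.tCounit_tX i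

theorem tProj_tGrp (h : Γ) : W.tProj (W.tGrp h) = MonoidAlgebra.of K Γ h := by
  rw [tProj, tLift_tGrp]

theorem tProj_tX (i : Fin θ) : W.tProj (W.tX i) = 0 := by
  rw [tProj, tLift_tX]

theorem proj_grp (h : Γ) : W.proj (W.grp h) = MonoidAlgebra.of K Γ h := W.tProj_tGrp h

theorem proj_x (i : Fin θ) : W.proj (W.x i) = 0 := W.tProj_tX i

theorem adjoin_range_tGrp_union_range_tX :
    Algebra.adjoin K (Set.range W.tGrp ∪ Set.range W.tX) = ⊤ := by
  have generators : Set.range W.tGrp ∪ Set.range W.tX =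
      RingQuot.mkAlgHom K W.Rel '' Set.range (FreeAlgebra.ι K) := by
    rw [← Set.range_comp, ← Set.Sum.elim_range]
    exact congrArg Set.range (funext fun | .inl _ => rfl | .inr _ => rfl)
  rw [generators, ← AlgHom.map_adjoin, FreeAlgebra.adjoin_range_ι, Algebra.map_top,
    AlgHom.range_eq_top]
  exact RingQuot.mkAlgHom_surjective K W.Rel

theorem tInduction_right {p : Submodule K W.TensorBoson} (one : 1 ∈ p)
    (mul_tGrp : ∀ y ∈ p, ∀ h, y * W.tGrp h ∈ p) (mul_tX : ∀ y ∈ p, ∀ i, y * W.tX i ∈ p)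
    (y : W.TensorBoson) : y ∈ p := by
  have hy : y ∈ Algebra.adjoin K (Set.range W.tGrp ∪ Set.range W.tX) := by
    rw [adjoin_range_tGrp_union_range_tX]
    exact Algebra.mem_top
  refine adjoin_toSubmodule_le_of_mul_mem_right one ?_ hy
  rintro y hy b (⟨h, rfl⟩ | ⟨i, rfl⟩)
  exacts [mul_tGrp y hy h, mul_tX y hy i]

theorem induction_right {p : Submodule K W.A} (one : 1 ∈ p)
    (mul_grp : ∀ y ∈ p, ∀ h, y * W.grp h ∈ p) (mul_x : ∀ y ∈ p, ∀ i, y * W.x i ∈ p)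
    (y : W.A) : y ∈ p := by
  obtain ⟨y, rfl⟩ := Ideal.Quotient.mk_surjective y
  exact W.tInduction_right
    (p := p.comap (Ideal.Quotient.mkₐ K W.nicholsIdeal).toLinearMap) one
    (fun y hy h => mul_grp _ hy h) (fun y hy i => mul_x _ hy i) y

theorem ker_tProj_le_ker {B : Type*} [Semiring B] [Algebra K B] {f : W.TensorBoson →ₐ[K] B}
    (hf : ∀ i, f (W.tX i) = 0) : RingHom.ker W.tProj ≤ RingHom.ker f := by
  let F : MonoidAlgebra K Γ →ₐ[K] B := MonoidAlgebra.lift K B Γ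
    { toFun := fun h => f (W.tGrp h)
      map_one' := by rw [tGrp_one, map_one]
      map_mul' := fun h k => by rw [tGrp_mul, map_mul] }
  have factor : f = F.comp W.tProj :=
    W.tHom_ext (fun h => by simp [tProj_tGrp, F]) (fun i => by simp [tProj_tX, hf])
  intro y hy
  rw [RingHom.mem_ker] at hy ⊢
  rw [factor, AlgHom.comp_apply, hy, map_zero]

theorem mk_eq_zero_of_skewPrimitive {s b : W.TensorBoson} (hs : s ∈ RingHom.ker W.tProj ^ 2)
    (hΔ : W.tComul s = s ⊗ₜ 1 + b ⊗ₜ s) : Ideal.Quotient.mk W.nicholsIdeal s = 0 := by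
  have counit_eq_zero : W.tCounit s = 0 :=
    W.ker_tProj_le_ker W.tCounit_tX (Ideal.pow_le_self two_ne_zero hs)
  have span_le : TwoSidedIdeal.span {s} ≤ (RingHom.ker W.tProj ^ 2).toTwoSided :=
    TwoSidedIdeal.span_le.2 <| Set.singleton_subset_iff.2 <| Ideal.mem_toTwoSided.2 hs
  have isNichols : W.IsNicholsBiideal (TwoSidedIdeal.span {s}).asIdeal :=
    ⟨inferInstance, isCoideal_span_of_comul_eq counit_eq_zero hΔ,
      fun _ hy => Ideal.mem_toTwoSided.1 (span_le (TwoSidedIdeal.mem_asIdeal.1 hy))⟩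
  exact Ideal.Quotient.eq_zero_iff_mem.2 (le_sSup (a := (TwoSidedIdeal.span {s}).asIdeal) isNichols
    (TwoSidedIdeal.mem_asIdeal.2 (TwoSidedIdeal.subset_span rfl)))

theorem tX_mem_ker (i : Fin θ) : W.tX i ∈ RingHom.ker W.tProj := W.tProj_tX i

theorem isPrimitiveRoot (i : Fin θ) : IsPrimitiveRoot (W.χ i (W.g i) : K) (W.r i) :=
  IsPrimitiveRoot.coe_units_iff.2 (W.primitive i)

theorem r_ne_zero (i : Fin θ) : W.r i ≠ 0 := (zero_lt_two.trans_le (W.two_le i)).ne'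

theorem x_pow_r (i : Fin θ) : W.x i ^ W.r i = 0 := by
  have hcomm : QCommute (W.χ i (W.g i) : K) (W.tGrp (W.g i) ⊗ₜ[K] W.tX i) (W.tX i ⊗ₜ[K] 1) := by
    simp only [QCommute, Algebra.TensorProduct.tmul_mul_tmul, tGrp_mul_tX, one_mul, mul_one,
      TensorProduct.smul_tmul']
  rw [x, ← map_pow]
  refine W.mk_eq_zero_of_skewPrimitive (b := W.tGrp (W.g i) ^ W.r i)
    (Ideal.pow_le_pow_right (W.two_le i) (Ideal.pow_mem_pow (W.tX_mem_ker i) _)) ?_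
  rw [map_pow, tComul_tX, hcomm.add_pow_of_isPrimitiveRoot (W.isPrimitiveRoot i) (W.r_ne_zero i),
    Algebra.TensorProduct.tmul_pow, Algebra.TensorProduct.tmul_pow, one_pow]

theorem x_mul_x {i j : Fin θ} (hij : i ≠ j) :
    QCommute (W.χ j (W.g i) : K) (W.x i) (W.x j) := by
  have hχ : (W.χ i (W.g j) : K) * (W.χ j (W.g i) : K) = 1 := by
    rw [← Units.val_mul, W.braiding i j hij, Units.val_one]
  have hcomm : W.tGrp (W.g j) * W.tGrp (W.g i) = W.tGrp (W.g i) * W.tGrp (W.g j) := by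
    rw [← tGrp_mul, ← tGrp_mul, mul_comm]
  have mem_sq : ∀ i j, W.tX i * W.tX j ∈ RingHom.ker W.tProj ^ 2 := fun i j => by
    rw [Submodule.pow_succ, Submodule.pow_one]
    exact Ideal.mul_mem_mul (W.tX_mem_ker i) (W.tX_mem_ker j)
  rw [QCommute, ← sub_eq_zero]
  refine W.mk_eq_zero_of_skewPrimitive (b := W.tGrp (W.g i * W.g j))
    (s := W.tX i * W.tX j - (W.χ j (W.g i) : K) • (W.tX j * W.tX i)) ?_ ?_
  · rw [Algebra.smul_def]
    exact sub_mem (mem_sq i j) (Ideal.mul_mem_left _ _ (mem_sq j i))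
  · simp only [map_sub, map_smul, map_mul, tComul_tX, mul_add, add_mul,
      Algebra.TensorProduct.tmul_mul_tmul, tGrp_mul_tX, mul_one, one_mul, smul_add, tGrp_mul,
      ← TensorProduct.smul_tmul', TensorProduct.tmul_smul, TensorProduct.sub_tmul,
      TensorProduct.tmul_sub, smul_smul, hcomm, mul_comm (W.χ j (W.g i) : K), hχ, one_smul]
    abel

/-! ### Monomials -/

theorem mono_eq_prod_map (n : Fin θ → ℕ) :
    W.mono n = ((List.finRange θ).map fun i => W.x i ^ n i).prod := by
  rw [mono, List.ofFn_eq_map]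

theorem exists_mono_mul_x (n : Fin θ → ℕ) (j : Fin θ) :
    ∃ c : Kˣ, W.mono n * W.x j = (c : K) • W.mono (n + Pi.single j 1) := by
  simp only [mono_eq_prod_map]
  exact exists_prod_map_pow_mul (fun i k hik => ⟨W.χ k (W.g i), W.x_mul_x hik⟩) n
    (List.nodup_finRange θ) (List.mem_finRange j)

theorem mono_single (i : Fin θ) (k : ℕ) : W.mono (Pi.single i k) = W.x i ^ k := by
  rw [mono_eq_prod_map, List.prod_map_eq_pow_single i, List.count_eq_one_of_mem
    (List.nodup_finRange θ) (List.mem_finRange i), Pi.single_eq_same, pow_one]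
  intro j hji _
  rw [Pi.single_eq_of_ne hji, pow_zero]

theorem mono_zero : W.mono 0 = 1 := by
  simp only [mono_eq_prod_map, Pi.zero_apply, pow_zero, List.map_const', List.prod_replicate,
    one_pow]

theorem mono_eq_zero {n : Fin θ → ℕ} {j : Fin θ} (hj : n j = W.r j) : W.mono n = 0 :=
  List.prod_eq_zero (List.mem_ofFn.2 ⟨j, by simp only [hj, x_pow_r]⟩)

/-- The elements `x_1 ^ n_1 ⋯ x_θ ^ n_θ h` of `A`, with `n_j < r_j` and `h ∈ Γ`. -/
def reducedMonomials : Set W.A :=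
  {y | ∃ n : Fin θ → ℕ, (∀ j, n j < W.r j) ∧ ∃ h, y = W.mono n * W.grp h}

theorem mul_x_mem_span_reducedMonomials {y : W.A} (hy : y ∈ W.reducedMonomials) (j : Fin θ) :
    y * W.x j ∈ Submodule.span K W.reducedMonomials := by
  obtain ⟨n, hn, h, rfl⟩ := hy
  obtain ⟨c, hc⟩ := W.exists_mono_mul_x n j
  rw [mul_assoc, W.grp_mul_x h j, mul_smul_comm, ← mul_assoc, hc, smul_mul_assoc, smul_smul]
  refine Submodule.smul_mem _ _ ?_
  obtain hj | hj := (Nat.succ_le_of_lt (hn j)).eq_or_lt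
  · rw [W.mono_eq_zero (j := j) (by simpa using hj), zero_mul]
    exact zero_mem _
  · refine Submodule.subset_span ⟨_, fun l => ?_, h, rfl⟩
    obtain rfl | hl := eq_or_ne l j
    · simpa using hj
    · simpa [Pi.single_eq_of_ne hl] using hn l

theorem span_reducedMonomials : Submodule.span K W.reducedMonomials = ⊤ := by
  refine Submodule.eq_top_iff'.2 (W.induction_right ?_ ?_ ?_)
  · exact Submodule.subset_span
      ⟨0, fun j => (W.r_ne_zero j).bot_lt, 1, by rw [mono_zero, grp_one, mul_one]⟩
  · intro y hy h
    refine (Submodule.span_le (p := (Submodule.span K W.reducedMonomials).comap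
      (LinearMap.mulRight K (W.grp h)))).2 ?_ hy
    rintro _ ⟨n, hn, k, rfl⟩
    exact Submodule.subset_span
      ⟨n, hn, k * h, by rw [LinearMap.mulRight_apply, grp_mul, mul_assoc]⟩
  · intro y hy j
    exact (Submodule.span_le (p := (Submodule.span K W.reducedMonomials).comap
      (LinearMap.mulRight K (W.x j)))).2 (fun _ hz => W.mul_x_mem_span_reducedMonomials hz j) hy

end QuantumLinearSpace

/-! ### Convolution -/

section Convolution

open WithConv

section Scalar

variable {R C : Type*} [CommSemiring R] [AddCommMonoid C] [Module R C]

section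

variable (B : Type*) [Semiring B] [Algebra R B]

/-- A scalar-valued map, seen as a map with values in an algebra `B`. Both are elements of
convolution algebras when the source is a coalgebra. -/
def convScalar (φ : WithConv (C →ₗ[R] R)) : WithConv (C →ₗ[R] B) :=
  toConv (Algebra.linearMap R B ∘ₗ φ.ofConv)

theorem convScalar_apply (φ : WithConv (C →ₗ[R] R)) (y : C) :
    convScalar B φ y = algebraMap R B (φ y) := rfl

theorem convScalar_zero : convScalar B (0 : WithConv (C →ₗ[R] R)) = 0 :=
  ofConv_injective (LinearMap.comp_zero _)

theorem convScalar_add (φ ψ : WithConv (C →ₗ[R] R)) :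
    convScalar B (φ + ψ) = convScalar B φ + convScalar B ψ :=
  ofConv_injective (LinearMap.comp_add φ.ofConv ψ.ofConv _)

theorem convScalar_smul (c : R) (φ : WithConv (C →ₗ[R] R)) :
    convScalar B (c • φ) = c • convScalar B φ :=
  ofConv_injective (LinearMap.comp_smul _ c φ.ofConv)

variable [Coalgebra R C]

theorem convScalar_one : convScalar B (1 : WithConv (C →ₗ[R] R)) = 1 := rfl

theorem convScalar_mul (φ ψ : WithConv (C →ₗ[R] R)) :
    convScalar B (φ * ψ) = convScalar B φ * convScalar B ψ :=
  congrArg toConv (LinearMap.algHom_comp_convMul_distrib (Algebra.ofId R B) φ ψ)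

end

variable [Coalgebra R C] {B : Type*} [Semiring B] [Algebra R B]

theorem comp_convScalar_mul (f : B →ₗ[R] R) (φ : WithConv (C →ₗ[R] R))
    (Φ : WithConv (C →ₗ[R] B)) :
    toConv (f ∘ₗ (convScalar B φ * Φ).ofConv) = φ * toConv (f ∘ₗ Φ.ofConv) := by
  have on_tensor : f ∘ₗ LinearMap.mul' R B ∘ₗ
      TensorProduct.map (convScalar B φ).ofConv Φ.ofConv =
      LinearMap.mul' R R ∘ₗ TensorProduct.map φ.ofConv (f ∘ₗ Φ.ofConv) :=
    TensorProduct.ext' fun y z => by simp [convScalar_apply, ← Algebra.smul_def]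
  exact congrArg toConv (congrArg (· ∘ₗ Coalgebra.comul) on_tensor)

theorem comp_mul_convScalar (f : B →ₗ[R] R) (φ : WithConv (C →ₗ[R] R))
    (Φ : WithConv (C →ₗ[R] B)) :
    toConv (f ∘ₗ (Φ * convScalar B φ).ofConv) = toConv (f ∘ₗ Φ.ofConv) * φ := by
  have on_tensor : f ∘ₗ LinearMap.mul' R B ∘ₗ
      TensorProduct.map Φ.ofConv (convScalar B φ).ofConv =
      LinearMap.mul' R R ∘ₗ TensorProduct.map (f ∘ₗ Φ.ofConv) φ.ofConv :=
    TensorProduct.ext' fun y z => by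
      simp [convScalar_apply, ← Algebra.commutes, ← Algebra.smul_def, mul_comm]
  exact congrArg toConv (congrArg (· ∘ₗ Coalgebra.comul) on_tensor)

end Scalar

section Box

variable {R C B : Type*} [CommSemiring R] [AddCommMonoid C] [Module R C]
  [CommSemiring B] [Algebra R B]

theorem convSmul_apply (b : B) (Φ : WithConv (C →ₗ[R] B)) (y : C) : (b • Φ) y = b * Φ y := rfl

/-- The map `y ⊗ z ↦ Φ(y) Ψ(z)` on `C ⊗ C`. -/
def convBox (Φ Ψ : WithConv (C →ₗ[R] B)) : WithConv (C ⊗[R] C →ₗ[R] B) :=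
  toConv (LinearMap.mul' R B ∘ₗ TensorProduct.map Φ.ofConv Ψ.ofConv)

theorem convBox_smul_left (b : B) (Φ Ψ : WithConv (C →ₗ[R] B)) :
    convBox (b • Φ) Ψ = b • convBox Φ Ψ :=
  ofConv_injective (TensorProduct.ext' fun y z => smul_mul_assoc b (Φ y) (Ψ z))

theorem convBox_smul_right (b : B) (Φ Ψ : WithConv (C →ₗ[R] B)) :
    convBox Φ (b • Ψ) = b • convBox Φ Ψ :=
  ofConv_injective (TensorProduct.ext' fun y z => mul_smul_comm b (Φ y) (Ψ z))

theorem convBox_zero_left (Ψ : WithConv (C →ₗ[R] B)) : convBox 0 Ψ = 0 :=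
  ofConv_injective (TensorProduct.ext' fun _ z => zero_mul (Ψ z))

theorem convBox_zero_right (Φ : WithConv (C →ₗ[R] B)) : convBox Φ 0 = 0 :=
  ofConv_injective (TensorProduct.ext' fun y _ => mul_zero (Φ y))

theorem convScalar_convBox (φ ψ : WithConv (C →ₗ[R] R)) :
    convScalar B (convBox φ ψ) = convBox (convScalar B φ) (convScalar B ψ) :=
  ofConv_injective (TensorProduct.ext' fun y z => map_mul (algebraMap R B) (φ y) (ψ z))

variable [Coalgebra R C]

theorem convBox_mul_convBox (Φ Ψ Φ' Ψ' : WithConv (C →ₗ[R] B)) :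
    convBox Φ Ψ * convBox Φ' Ψ' = convBox (Φ * Φ') (Ψ * Ψ') := by
  have distrib := LinearMap.algHom_comp_convMul_distrib (R := R)
    (Algebra.TensorProduct.lmul' R (S := B))
    (toConv (TensorProduct.map Φ.ofConv Ψ.ofConv)) (toConv (TensorProduct.map Φ'.ofConv Ψ'.ofConv))
  rw [TensorProduct.map_convMul_map (f := Φ) (g := Ψ) (h := Φ') (k := Ψ')] at distrib
  exact (congrArg toConv distrib).symm

end Box

section Weight

variable {R C B : Type*} [CommSemiring R] [AddCommMonoid C] [Module R C] [Coalgebra R C]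
  [CommSemiring B] [Algebra R B]

/-- The scalar-valued maps `φ` of weight `b ∈ B` with respect to `P : C → B`: those with
`P * φ = b (φ * P)` for the convolution product. -/
def weightSpace (P : WithConv (C →ₗ[R] B)) (b : B) : Submodule R (WithConv (C →ₗ[R] R)) where
  carrier := {φ | P * convScalar B φ = b • (convScalar B φ * P)}
  zero_mem' := show P * convScalar B 0 = b • (convScalar B 0 * P) by
    rw [convScalar_zero, mul_zero, zero_mul, smul_zero]
  add_mem' {φ ψ} hφ hψ := show P * convScalar B (φ + ψ) = b • (convScalar B (φ + ψ) * P) by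
    rw [convScalar_add, mul_add, add_mul, hφ, hψ, smul_add]
  smul_mem' c φ hφ := show P * convScalar B (c • φ) = b • (convScalar B (c • φ) * P) by
    rw [convScalar_smul, mul_smul_comm, hφ, smul_mul_assoc, smul_comm]

variable {P : WithConv (C →ₗ[R] B)} {b c : B} {φ ψ : WithConv (C →ₗ[R] R)}

theorem mem_weightSpace :
    φ ∈ weightSpace P b ↔ P * convScalar B φ = b • (convScalar B φ * P) := Iff.rfl

theorem one_mem_weightSpace : (1 : WithConv (C →ₗ[R] R)) ∈ weightSpace P (1 : B) := by
  rw [mem_weightSpace, convScalar_one, one_smul, one_mul, mul_one]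

theorem mul_mem_weightSpace (hφ : φ ∈ weightSpace P b) (hψ : ψ ∈ weightSpace P c) :
    φ * ψ ∈ weightSpace P (b * c) := by
  rw [mem_weightSpace] at hφ hψ ⊢
  rw [convScalar_mul, ← mul_assoc, hφ, smul_mul_assoc, mul_assoc, hψ, mul_smul_comm, smul_smul,
    mul_assoc]

theorem pow_mem_weightSpace (hφ : φ ∈ weightSpace P b) (n : ℕ) : φ ^ n ∈ weightSpace P (b ^ n) := by
  induction n with
  | zero => simpa only [pow_zero] using one_mem_weightSpace
  | succ n ih => simpa only [pow_succ] using mul_mem_weightSpace ih hφ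

theorem convBox_mem_weightSpace (hφ : φ ∈ weightSpace P b) (hψ : ψ ∈ weightSpace P c) :
    convBox φ ψ ∈ weightSpace (convBox P P) (b * c) := by
  rw [mem_weightSpace] at hφ hψ ⊢
  rw [convScalar_convBox, convBox_mul_convBox, hφ, hψ, convBox_smul_left, convBox_smul_right,
    smul_smul, convBox_mul_convBox]

end Weight

section Translation

variable {R A B : Type*} [CommSemiring R] [Semiring A] [Bialgebra R A] [CommSemiring B]
  [Algebra R B]

theorem convMul_apply_one (Φ Ψ : WithConv (A →ₗ[R] B)) : (Φ * Ψ) 1 = Φ 1 * Ψ 1 := by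
  rw [LinearMap.convMul_apply, Bialgebra.comul_one, Algebra.TensorProduct.one_def,
    TensorProduct.map_tmul, LinearMap.mul'_apply]

theorem convPow_apply_one (Φ : WithConv (A →ₗ[R] B)) (n : ℕ) : (Φ ^ n) 1 = Φ 1 ^ n := by
  induction n with
  | zero => rw [pow_zero, pow_zero, LinearMap.convOne_apply, Bialgebra.counit_one, map_one]
  | succ n ih => rw [pow_succ, pow_succ, convMul_apply_one, ih]

/-- The translate `y ↦ Φ(a y)` of a map `Φ` on a bialgebra. -/
def translateLeft (a : A) : WithConv (A →ₗ[R] B) →ₗ[B] WithConv (A →ₗ[R] B) where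
  toFun Φ := toConv (Φ.ofConv ∘ₗ LinearMap.mulLeft R a)
  map_add' _ _ := rfl
  map_smul' _ _ := rfl

/-- The translate `y ↦ Φ(y a)` of a map `Φ` on a bialgebra. -/
def translateRight (a : A) : WithConv (A →ₗ[R] B) →ₗ[B] WithConv (A →ₗ[R] B) where
  toFun Φ := toConv (Φ.ofConv ∘ₗ LinearMap.mulRight R a)
  map_add' _ _ := rfl
  map_smul' _ _ := rfl

theorem translateLeft_apply (a : A) (Φ : WithConv (A →ₗ[R] B)) (y : A) :
    translateLeft a Φ y = Φ (a * y) := rfl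

theorem translateRight_apply (a : A) (Φ : WithConv (A →ₗ[R] B)) (y : A) :
    translateRight a Φ y = Φ (y * a) := rfl

theorem translateRight_convScalar (a : A) (φ : WithConv (A →ₗ[R] R)) :
    translateRight a (convScalar B φ) = convScalar B (translateRight a φ) := rfl

section GroupLike

variable {g : A} (hg : IsGroupLikeElem R g)
include hg

theorem translateLeft_mul (Φ Ψ : WithConv (A →ₗ[R] B)) :
    translateLeft g (Φ * Ψ) = translateLeft g Φ * translateLeft g Ψ := by
  have on_tensor : (LinearMap.mul' R B ∘ₗ TensorProduct.map Φ.ofConv Ψ.ofConv) ∘ₗ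
      LinearMap.mulLeft R (g ⊗ₜ[R] g) = LinearMap.mul' R B ∘ₗ
        TensorProduct.map (translateLeft g Φ).ofConv (translateLeft g Ψ).ofConv :=
    TensorProduct.ext' fun y z => by simp [translateLeft_apply]
  refine ofConv_injective (LinearMap.ext fun y => ?_)
  rw [translateLeft_apply, LinearMap.convMul_apply, LinearMap.convMul_apply, Bialgebra.comul_mul,
    hg.comul_eq_tmul_self]
  exact LinearMap.congr_fun on_tensor (Coalgebra.comul y)

theorem translateRight_mul (Φ Ψ : WithConv (A →ₗ[R] B)) :
    translateRight g (Φ * Ψ) = translateRight g Φ * translateRight g Ψ := by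
  have on_tensor : (LinearMap.mul' R B ∘ₗ TensorProduct.map Φ.ofConv Ψ.ofConv) ∘ₗ
      LinearMap.mulRight R (g ⊗ₜ[R] g) = LinearMap.mul' R B ∘ₗ
        TensorProduct.map (translateRight g Φ).ofConv (translateRight g Ψ).ofConv :=
    TensorProduct.ext' fun y z => by simp [translateRight_apply]
  refine ofConv_injective (LinearMap.ext fun y => ?_)
  rw [translateRight_apply, LinearMap.convMul_apply, LinearMap.convMul_apply, Bialgebra.comul_mul,
    hg.comul_eq_tmul_self]
  exact LinearMap.congr_fun on_tensor (Coalgebra.comul y)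

theorem translateLeft_pow (Φ : WithConv (A →ₗ[R] B)) (n : ℕ) :
    translateLeft g (Φ ^ n) = translateLeft g Φ ^ n := by
  induction n with
  | zero =>
    refine ofConv_injective (LinearMap.ext fun y => ?_)
    rw [pow_zero, pow_zero, translateLeft_apply, LinearMap.convOne_apply, LinearMap.convOne_apply,
      Bialgebra.counit_mul, hg.counit_eq_one, one_mul]
  | succ n ih => rw [pow_succ, pow_succ, translateLeft_mul hg, ih]

theorem translateRight_pow (Φ : WithConv (A →ₗ[R] B)) (n : ℕ) :
    translateRight g (Φ ^ n) = translateRight g Φ ^ n := by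
  induction n with
  | zero =>
    refine ofConv_injective (LinearMap.ext fun y => ?_)
    rw [pow_zero, pow_zero, translateRight_apply, LinearMap.convOne_apply, LinearMap.convOne_apply,
      Bialgebra.counit_mul, hg.counit_eq_one, mul_one]
  | succ n ih => rw [pow_succ, pow_succ, translateRight_mul hg, ih]

end GroupLike

theorem translateRight_mul_of_comul_eq {x g : A}
    (hx : Coalgebra.comul (R := R) x = x ⊗ₜ 1 + g ⊗ₜ x) (Φ Ψ : WithConv (A →ₗ[R] B)) :
    translateRight x (Φ * Ψ) =
      translateRight x Φ * Ψ + translateRight g Φ * translateRight x Ψ := by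
  have on_tensor : (LinearMap.mul' R B ∘ₗ TensorProduct.map Φ.ofConv Ψ.ofConv) ∘ₗ
      LinearMap.mulRight R (x ⊗ₜ[R] 1 + g ⊗ₜ[R] x) =
      LinearMap.mul' R B ∘ₗ TensorProduct.map (translateRight x Φ).ofConv Ψ.ofConv +
      LinearMap.mul' R B ∘ₗ
        TensorProduct.map (translateRight g Φ).ofConv (translateRight x Ψ).ofConv :=
    TensorProduct.ext' fun y z => by simp [translateRight_apply, mul_add]
  refine ofConv_injective (LinearMap.ext fun y => ?_)
  rw [translateRight_apply, LinearMap.convMul_apply, Bialgebra.comul_mul, hx]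
  exact LinearMap.congr_fun on_tensor (Coalgebra.comul y)

end Translation

section Coinvariants

variable {R A B : Type*} [CommSemiring R] [Semiring A] [Bialgebra R A]

/-- The coinvariants of `A` for the right coaction `(id ⊗ f) ∘ Δ`. -/
def coinvariants [Semiring B] [Algebra R B] (f : A →ₐ[R] B) : Subalgebra R A :=
  AlgHom.equalizer
    ((Algebra.TensorProduct.map (AlgHom.id R A) f).comp (Bialgebra.comulAlgHom R A))
    Algebra.TensorProduct.includeLeft

theorem mem_coinvariants [Semiring B] [Algebra R B] {f : A →ₐ[R] B} {y : A} :
    y ∈ coinvariants f ↔ TensorProduct.map LinearMap.id f.toLinearMap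
      (Coalgebra.comul (R := R) y) = y ⊗ₜ[R] (1 : B) := Iff.rfl

theorem mul_apply_of_mem_coinvariants [Semiring B] [Algebra R B] {f : A →ₐ[R] B} {y : A}
    (hy : y ∈ coinvariants f) (Φ : WithConv (A →ₗ[R] B)) :
    (Φ * toConv f.toLinearMap) y = Φ y := by
  have on_tensor : LinearMap.mul' R B ∘ₗ TensorProduct.map Φ.ofConv f.toLinearMap =
      LinearMap.mul' R B ∘ₗ TensorProduct.map Φ.ofConv LinearMap.id ∘ₗ
        TensorProduct.map LinearMap.id f.toLinearMap :=
    TensorProduct.ext' fun _ _ => rfl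
  refine (LinearMap.congr_fun on_tensor (Coalgebra.comul y)).trans ?_
  rw [LinearMap.comp_apply, LinearMap.comp_apply, mem_coinvariants.1 hy, TensorProduct.map_tmul,
    LinearMap.mul'_apply, LinearMap.id_apply, mul_one]

theorem tmul_mem_coinvariants [CommSemiring B] [Algebra R B] {f : A →ₐ[R] B} {y z : A}
    (hy : y ∈ coinvariants f) (hz : z ∈ coinvariants f) :
    y ⊗ₜ[R] z ∈ coinvariants
      ((Algebra.TensorProduct.lmul' R (S := B)).comp (Algebra.TensorProduct.map f f)) := by
  let mulCoaction : (A ⊗[R] B) ⊗[R] (A ⊗[R] B) →ₗ[R] (A ⊗[R] A) ⊗[R] B :=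
    TensorProduct.map LinearMap.id (LinearMap.mul' R B) ∘ₗ
      (TensorProduct.tensorTensorTensorComm R A B A B).toLinearMap
  let coactionOf : A ⊗[R] A →ₗ[R] A ⊗[R] B := TensorProduct.map LinearMap.id f.toLinearMap
  have on_tensor : TensorProduct.map LinearMap.id
      ((Algebra.TensorProduct.lmul' R (S := B)).comp (Algebra.TensorProduct.map f f)).toLinearMap ∘ₗ
        (TensorProduct.tensorTensorTensorComm R A A A A).toLinearMap =
      mulCoaction ∘ₗ TensorProduct.map coactionOf coactionOf :=
    TensorProduct.ext_fourfold' fun _ _ _ _ => rfl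
  refine (LinearMap.congr_fun on_tensor
    (Coalgebra.comul y ⊗ₜ Coalgebra.comul z)).trans ?_
  rw [LinearMap.comp_apply, TensorProduct.map_tmul, mem_coinvariants.1 hy, mem_coinvariants.1 hz]
  simp [mulCoaction]

end Coinvariants

end Convolution

namespace QuantumLinearSpace

open WithConv

variable {K : Type*} [Field K] {Γ : Type*} [CommGroup Γ] {θ : ℕ} (W : QuantumLinearSpace K Γ θ)

/-! ### Characters and skew derivations -/

/-- The character `χ_i` of `T(W) # K[Γ]`, extended by `0` on the `x_j`. -/
def tChar (i : Fin θ) : W.TensorBoson →ₐ[K] K :=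
  W.tLift (fun h => (W.χ i h : K)) (fun _ => 0) (by simp) (by simp) (by simp)

theorem tChar_tGrp (i : Fin θ) (h : Γ) : W.tChar i (W.tGrp h) = W.χ i h := by
  rw [tChar, tLift_tGrp]

theorem tChar_tX (i j : Fin θ) : W.tChar i (W.tX j) = 0 := by
  rw [tChar, tLift_tX]

/-- The representation of `T(W) # K[Γ]` by upper triangular matrices with diagonal `χ_i, ε`, in
which `x_i` acts by the matrix unit and the other `x_j` act by zero. Its upper right entry is a
skew derivation. -/
def tMatrix (i : Fin θ) : W.TensorBoson →ₐ[K] Matrix (Fin 2) (Fin 2) K :=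
  W.tLift (fun h => !![(W.χ i h : K), 0; 0, 1])
    (fun j => if j = i then !![0, 1; 0, 0] else 0)
    (by rw [map_one, Units.val_one, ← Matrix.one_fin_two])
    (fun h k => by simp)
    (fun h j => by
      obtain rfl | hj := eq_or_ne j i
      · simp
      · simp [hj])

theorem tMatrix_tGrp (i : Fin θ) (h : Γ) :
    W.tMatrix i (W.tGrp h) = !![(W.χ i h : K), 0; 0, 1] := by
  rw [tMatrix, tLift_tGrp]

theorem tMatrix_tX (i j : Fin θ) :
    W.tMatrix i (W.tX j) = if j = i then !![0, 1; 0, 0] else 0 := by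
  rw [tMatrix, tLift_tX]

theorem tMatrix_one_zero (i : Fin θ) (y : W.TensorBoson) : W.tMatrix i y 1 0 = 0 := by
  let entry := Matrix.entryLinearMap K K 1 0 ∘ₗ (W.tMatrix i).toLinearMap
  refine W.tInduction_right (p := LinearMap.ker entry) ?_ (fun y hy h => ?_) (fun y _ j => ?_) y
  · exact (congrFun₂ (map_one (W.tMatrix i)) 1 0).trans rfl
  · change W.tMatrix i y 1 0 = 0 at hy
    change W.tMatrix i (y * W.tGrp h) 1 0 = 0
    simp [Matrix.mul_apply, tMatrix_tGrp, hy]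
  · change W.tMatrix i (y * W.tX j) 1 0 = 0
    by_cases hj : j = i <;> simp [Matrix.mul_apply, tMatrix_tX, hj]

theorem tMatrix_zero_zero (i : Fin θ) (y : W.TensorBoson) :
    W.tMatrix i y 0 0 = W.tChar i y := by
  let entry := Matrix.entryLinearMap K K 0 0 ∘ₗ (W.tMatrix i).toLinearMap
  refine W.tInduction_right (p := LinearMap.eqLocus entry (W.tChar i).toLinearMap)
    ?_ (fun y hy h => ?_) (fun y _ j => ?_) y
  · exact (congrFun₂ (map_one (W.tMatrix i)) 0 0).trans (map_one (W.tChar i)).symm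
  · change W.tMatrix i y 0 0 = W.tChar i y at hy
    change W.tMatrix i (y * W.tGrp h) 0 0 = W.tChar i (y * W.tGrp h)
    simp [Matrix.mul_apply, tMatrix_tGrp, tChar_tGrp, hy]
  · change W.tMatrix i (y * W.tX j) 0 0 = W.tChar i (y * W.tX j)
    by_cases hj : j = i <;> simp [Matrix.mul_apply, tMatrix_tX, tChar_tX, hj]

theorem tMatrix_one_one (i : Fin θ) (y : W.TensorBoson) :
    W.tMatrix i y 1 1 = W.tCounit y := by
  let entry := Matrix.entryLinearMap K K 1 1 ∘ₗ (W.tMatrix i).toLinearMap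
  refine W.tInduction_right (p := LinearMap.eqLocus entry W.tCounit.toLinearMap)
    ?_ (fun y hy h => ?_) (fun y _ j => ?_) y
  · exact (congrFun₂ (map_one (W.tMatrix i)) 1 1).trans (map_one W.tCounit).symm
  · change W.tMatrix i y 1 1 = W.tCounit y at hy
    change W.tMatrix i (y * W.tGrp h) 1 1 = W.tCounit (y * W.tGrp h)
    simp [Matrix.mul_apply, tMatrix_tGrp, tCounit_tGrp, hy]
  · change W.tMatrix i (y * W.tX j) 1 1 = W.tCounit (y * W.tX j)
    by_cases hj : j = i <;> simp [Matrix.mul_apply, tMatrix_tX, tMatrix_one_zero, tCounit_tX, hj]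

/-- The skew derivation `∂_i` of `T(W) # K[Γ]`: `∂_i(y z) = ∂_i(y) ε(z) + χ_i(y) ∂_i(z)`, with
`∂_i(h) = 0` for `h ∈ Γ` and `∂_i(x_j) = δ_{ij}`. -/
def tDer (i : Fin θ) : W.TensorBoson →ₗ[K] K :=
  Matrix.entryLinearMap K K 0 1 ∘ₗ (W.tMatrix i).toLinearMap

theorem tDer_apply (i : Fin θ) (y : W.TensorBoson) : W.tDer i y = W.tMatrix i y 0 1 := rfl

theorem tDer_mul (i : Fin θ) (y z : W.TensorBoson) :
    W.tDer i (y * z) = W.tDer i y * W.tCounit z + W.tChar i y * W.tDer i z := by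
  simp only [tDer_apply, map_mul, Matrix.mul_apply, Fin.sum_univ_two, tMatrix_zero_zero,
    tMatrix_one_one]
  rw [add_comm]

theorem tDer_eq_zero_of_mem_ker_sq (i : Fin θ) {y : W.TensorBoson}
    (hy : y ∈ RingHom.ker W.tProj ^ 2) : W.tDer i y = 0 := by
  rw [Submodule.pow_succ, Submodule.pow_one] at hy
  induction hy using Submodule.mul_induction_on' with
  | mem_mul_mem a ha b hb =>
    rw [tDer_mul, W.ker_tProj_le_ker W.tCounit_tX hb, W.ker_tProj_le_ker (W.tChar_tX i) ha,
      mul_zero, zero_mul, add_zero]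
  | add a _ b _ ha hb => rw [map_add, ha, hb, add_zero]

theorem nicholsIdeal_le_ker_sq : W.nicholsIdeal ≤ RingHom.ker W.tProj ^ 2 :=
  sSup_le fun _ hI => hI.2.2

/-- The character `χ_i` of `A`, extended by `0` on the `x_j`. -/
def char (i : Fin θ) : W.A →ₐ[K] K :=
  Ideal.Quotient.liftₐ W.nicholsIdeal (W.tChar i) fun _ ha =>
    W.ker_tProj_le_ker (W.tChar_tX i) (W.nicholsIdeal_le_ker_tProj ha)

/-- The skew derivation `∂_i` of `A`, induced by that of `T(W) # K[Γ]`. -/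
def der (i : Fin θ) : W.A →ₗ[K] K :=
  (W.nicholsIdeal.restrictScalars K).liftQ (W.tDer i) fun _ ha =>
    W.tDer_eq_zero_of_mem_ker_sq i (W.nicholsIdeal_le_ker_sq ha)

theorem char_grp (i : Fin θ) (h : Γ) : W.char i (W.grp h) = W.χ i h := W.tChar_tGrp i h

theorem char_x (i j : Fin θ) : W.char i (W.x j) = 0 := W.tChar_tX i j

theorem der_grp (i : Fin θ) (h : Γ) : W.der i (W.grp h) = 0 :=
  (congrFun₂ (W.tMatrix_tGrp i h) 0 1).trans rfl

theorem der_x (i j : Fin θ) : W.der i (W.x j) = if j = i then 1 else 0 := by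
  refine (congrFun₂ (W.tMatrix_tX i j) 0 1).trans ?_
  split_ifs <;> rfl

theorem der_mul (i : Fin θ) (y z : W.A) :
    W.der i (y * z) = W.der i y * Coalgebra.counit (R := K) z + W.char i y * W.der i z := by
  obtain ⟨y, rfl⟩ := Ideal.Quotient.mk_surjective y
  obtain ⟨z, rfl⟩ := Ideal.Quotient.mk_surjective z
  exact W.tDer_mul i y z

theorem nichols_le_coinvariants {B : Type*} [Semiring B] [Algebra K B] {f : W.A →ₐ[K] B}
    (hf : ∀ i, f (W.x i) = 0) : W.nichols ≤ coinvariants f := by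
  refine Algebra.adjoin_le ?_
  rintro _ ⟨i, rfl⟩
  refine mem_coinvariants.2 ?_
  rw [comul_x, map_add, TensorProduct.map_tmul, TensorProduct.map_tmul, AlgHom.toLinearMap_apply,
    AlgHom.toLinearMap_apply, hf, map_one, TensorProduct.tmul_zero, add_zero, LinearMap.id_apply]

/-- The projection `π : A → K[Γ]`, in the convolution algebra. -/
def convProj : WithConv (W.A →ₗ[K] MonoidAlgebra K Γ) := toConv W.proj.toLinearMap

/-- The character `χ_i` of `A`, in the convolution algebra. -/
def convChar (i : Fin θ) : WithConv (W.A →ₗ[K] K) := toConv (W.char i).toLinearMap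

/-- The skew derivation `∂_i` of `A`, in the convolution algebra. -/
def convDer (i : Fin θ) : WithConv (W.A →ₗ[K] K) := toConv (W.der i)

theorem convDer_one (i : Fin θ) : W.convDer i 1 = 0 := by
  rw [← grp_one]
  exact W.der_grp i 1

theorem translateRight_grp_convProj (h : Γ) :
    translateRight (W.grp h) W.convProj = MonoidAlgebra.of K Γ h • W.convProj :=
  ofConv_injective <| LinearMap.ext fun y => show W.proj (y * W.grp h) =
    MonoidAlgebra.of K Γ h * W.proj y by rw [map_mul, proj_grp, mul_comm]

theorem translateRight_x_convProj (j : Fin θ) : translateRight (W.x j) W.convProj = 0 :=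
  ofConv_injective <| LinearMap.ext fun y => show W.proj (y * W.x j) = 0 by
    rw [map_mul, proj_x, mul_zero]

theorem translateRight_grp_convChar (h : Γ) (i : Fin θ) :
    translateRight (W.grp h) (W.convChar i) = (W.χ i h : K) • W.convChar i :=
  ofConv_injective <| LinearMap.ext fun y => show W.char i (y * W.grp h) =
    (W.χ i h : K) * W.char i y by rw [map_mul, char_grp, mul_comm]

theorem translateRight_x_convChar (j i : Fin θ) : translateRight (W.x j) (W.convChar i) = 0 :=
  ofConv_injective <| LinearMap.ext fun y => show W.char i (y * W.x j) = 0 by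
    rw [map_mul, char_x, mul_zero]

theorem translateRight_grp_convDer (h : Γ) (i : Fin θ) :
    translateRight (W.grp h) (W.convDer i) = W.convDer i :=
  ofConv_injective <| LinearMap.ext fun y => show W.der i (y * W.grp h) = W.der i y by
    rw [der_mul, der_grp, counit_grp, mul_zero, mul_one, add_zero]

theorem translateRight_x_convDer (j i : Fin θ) :
    translateRight (W.x j) (W.convDer i) = if j = i then W.convChar i else 0 := by
  refine ofConv_injective (LinearMap.ext fun y => ?_)
  change W.der i (y * W.x j) = _
  rw [der_mul, counit_x, mul_zero, zero_add, der_x]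
  split_ifs
  exacts [mul_one _, mul_zero _]

theorem translateRight_grp_mul (h : Γ) {B : Type*} [CommSemiring B] [Algebra K B]
    (Φ Ψ : WithConv (W.A →ₗ[K] B)) :
    translateRight (W.grp h) (Φ * Ψ) = translateRight (W.grp h) Φ * translateRight (W.grp h) Ψ :=
  translateRight_mul (W.isGroupLikeElem_grp h) Φ Ψ

theorem translateRight_x_mul (j : Fin θ) {B : Type*} [CommSemiring B] [Algebra K B]
    (Φ Ψ : WithConv (W.A →ₗ[K] B)) :
    translateRight (W.x j) (Φ * Ψ) = translateRight (W.x j) Φ * Ψ +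
      translateRight (W.grp (W.g j)) Φ * translateRight (W.x j) Ψ :=
  translateRight_mul_of_comul_eq (W.comul_x j) Φ Ψ

theorem ext_of_translateRight {B : Type*} [CommSemiring B] [Algebra K B]
    {Φ Ψ : WithConv (W.A →ₗ[K] B)} (one : Φ 1 = Ψ 1)
    (grp : ∀ h, ∃ b : B, translateRight (W.grp h) Φ = b • Φ ∧ translateRight (W.grp h) Ψ = b • Ψ)
    (x : ∀ j, translateRight (W.x j) Φ = translateRight (W.x j) Ψ) : Φ = Ψ := by
  refine ofConv_injective (LinearMap.ext (W.induction_right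
    (p := LinearMap.eqLocus Φ.ofConv Ψ.ofConv) one (fun y hy h => ?_) (fun y _ j => ?_)))
  · obtain ⟨b, hΦ, hΨ⟩ := grp h
    have at_y : b * Φ y = b * Ψ y := congrArg (b * ·) hy
    change translateRight (W.grp h) Φ y = translateRight (W.grp h) Ψ y
    rw [hΦ, hΨ]
    exact at_y
  · exact congrArg (fun Θ => Θ y) (x j)

theorem convChar_mem_weightSpace (i : Fin θ) : W.convChar i ∈ weightSpace W.convProj 1 := by
  have scale (h : Γ) (Φ : WithConv (W.A →ₗ[K] MonoidAlgebra K Γ)) :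
      ((W.χ i h : K) • MonoidAlgebra.of K Γ h) • Φ =
        (W.χ i h : K) • MonoidAlgebra.of K Γ h • Φ :=
    congrArg toConv (smul_assoc _ _ Φ.ofConv)
  rw [mem_weightSpace, one_smul]
  refine W.ext_of_translateRight ?_ (fun h => ⟨(W.χ i h : K) • MonoidAlgebra.of K Γ h, ?_, ?_⟩)
    (fun j => ?_)
  · rw [convMul_apply_one, convMul_apply_one, mul_comm]
  · rw [translateRight_grp_mul, translateRight_convScalar, translateRight_grp_convChar,
      translateRight_grp_convProj, convScalar_smul, smul_mul_assoc, mul_smul_comm, smul_comm,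
      scale]
  · rw [translateRight_grp_mul, translateRight_convScalar, translateRight_grp_convChar,
      translateRight_grp_convProj, convScalar_smul, smul_mul_assoc, mul_smul_comm, scale]
  · rw [translateRight_x_mul, translateRight_x_mul, translateRight_convScalar,
      translateRight_x_convChar, translateRight_x_convProj, convScalar_zero, mul_zero, mul_zero,
      zero_mul, zero_mul]

theorem convDer_mem_weightSpace (i : Fin θ) :
    W.convDer i ∈ weightSpace W.convProj (MonoidAlgebra.of K Γ (W.g i)) := by
  rw [mem_weightSpace]
  refine W.ext_of_translateRight ?_ (fun h => ⟨MonoidAlgebra.of K Γ h, ?_, ?_⟩) (fun j => ?_)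
  · rw [convSmul_apply, convMul_apply_one, convMul_apply_one, convScalar_apply,
      convDer_one, map_zero, mul_zero, zero_mul, mul_zero]
  · rw [translateRight_grp_mul, translateRight_convScalar, translateRight_grp_convDer,
      translateRight_grp_convProj, smul_mul_assoc]
  · rw [map_smul, translateRight_grp_mul, translateRight_convScalar, translateRight_grp_convDer,
      translateRight_grp_convProj, mul_smul_comm, smul_comm]
  · rw [map_smul, translateRight_x_mul, translateRight_x_mul, translateRight_convScalar,
      translateRight_x_convDer, translateRight_x_convProj, translateRight_grp_convProj, zero_mul,
      zero_add, mul_zero, add_zero]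
    split_ifs with hj
    · have char_comm := mem_weightSpace.1 (W.convChar_mem_weightSpace i)
      rw [one_smul] at char_comm
      rw [hj, smul_mul_assoc, char_comm]
    · rw [convScalar_zero, mul_zero, zero_mul, smul_zero]

theorem convChar_mul_convDer (i : Fin θ) :
    QCommute (W.χ i (W.g i) : K) (W.convChar i) (W.convDer i) := by
  refine W.ext_of_translateRight ?_ (fun h => ⟨W.χ i h, ?_, ?_⟩) (fun j => ?_)
  · rw [convSmul_apply, convMul_apply_one, convMul_apply_one, convDer_one, mul_zero,
      zero_mul, mul_zero]
  · rw [translateRight_grp_mul, translateRight_grp_convChar, translateRight_grp_convDer,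
      smul_mul_assoc]
  · rw [map_smul, translateRight_grp_mul, translateRight_grp_convChar,
      translateRight_grp_convDer, mul_smul_comm, smul_comm]
  · rw [map_smul, translateRight_x_mul, translateRight_x_mul, translateRight_x_convChar,
      translateRight_grp_convChar, translateRight_x_convDer, mul_zero, zero_mul, zero_add,
      add_zero]
    split_ifs with hj
    · rw [hj, smul_mul_assoc]
    · rw [mul_zero, zero_mul, smul_zero]

/-! ### Powers of the skew derivations -/

theorem translateRight_grp_convDer_pow (h : Γ) (i : Fin θ) (n : ℕ) :
    translateRight (W.grp h) (W.convDer i ^ n) = W.convDer i ^ n := by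
  rw [translateRight_pow (W.isGroupLikeElem_grp h), translateRight_grp_convDer]

theorem translateRight_x_convDer_pow_succ (i : Fin θ) (n : ℕ) :
    translateRight (W.x i) (W.convDer i ^ (n + 1)) =
      qInt (W.χ i (W.g i) : K) (n + 1) • (W.convDer i ^ n * W.convChar i) := by
  induction n with
  | zero => simp [translateRight_x_convDer, qInt]
  | succ n ih =>
    rw [pow_succ, translateRight_x_mul, ih, translateRight_grp_convDer_pow,
      translateRight_x_convDer, if_pos rfl, smul_mul_assoc, mul_assoc, W.convChar_mul_convDer i,
      mul_smul_comm, ← mul_assoc, ← pow_succ, smul_smul, qInt_succ _ (n + 1), add_smul, one_smul,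
      mul_comm]

theorem translateRight_x_convDer_pow_of_ne {i j : Fin θ} (hj : j ≠ i) (n : ℕ) :
    translateRight (W.x j) (W.convDer i ^ n) = 0 := by
  induction n with
  | zero =>
    refine ofConv_injective (LinearMap.ext fun y => ?_)
    change Coalgebra.counit (R := K) (y * W.x j) = 0
    rw [Bialgebra.counit_mul, counit_x, mul_zero]
  | succ n ih =>
    rw [pow_succ, translateRight_x_mul, ih, translateRight_x_convDer, if_neg hj, zero_mul,
      mul_zero, add_zero]

theorem convDer_pow_r (i : Fin θ) : W.convDer i ^ W.r i = 0 := by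
  refine W.ext_of_translateRight ?_ (fun h => ⟨1, ?_, ?_⟩) (fun j => ?_)
  · rw [convPow_apply_one, convDer_one, zero_pow (W.r_ne_zero i)]
    rfl
  · rw [translateRight_grp_convDer_pow, one_smul]
  · rw [map_zero, smul_zero]
  · rw [map_zero]
    obtain rfl | hj := eq_or_ne j i
    · obtain ⟨n, hn⟩ := Nat.exists_eq_succ_of_ne_zero (W.r_ne_zero j)
      have qInt_r := qInt_eq_zero (W.isPrimitiveRoot j) (W.two_le j)
      rw [hn] at qInt_r ⊢
      rw [translateRight_x_convDer_pow_succ, qInt_r, zero_smul]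
    · exact W.translateRight_x_convDer_pow_of_ne hj _

theorem mul_convChar_apply (φ : WithConv (W.A →ₗ[K] K)) (i : Fin θ) {y : W.A}
    (hy : y ∈ W.nichols) : (φ * W.convChar i) y = φ y :=
  mul_apply_of_mem_coinvariants (W.nichols_le_coinvariants (W.char_x i) hy) φ

theorem mul_convChar_pow_apply (φ : WithConv (W.A →ₗ[K] K)) (i : Fin θ) (l : ℕ) {y : W.A}
    (hy : y ∈ W.nichols) : (φ * W.convChar i ^ l) y = φ y := by
  induction l with
  | zero => rw [pow_zero, mul_one]
  | succ l ih => rw [pow_succ, ← mul_assoc, W.mul_convChar_apply _ _ hy, ih]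

theorem x_mem_nichols (i : Fin θ) : W.x i ∈ W.nichols :=
  Algebra.subset_adjoin ⟨i, rfl⟩

theorem mono_mem_nichols (n : Fin θ → ℕ) : W.mono n ∈ W.nichols := by
  refine Subalgebra.list_prod_mem _ fun y hy => ?_
  obtain ⟨i, rfl⟩ := List.mem_ofFn.1 hy
  exact pow_mem (W.x_mem_nichols i) _

theorem convDer_pow_x_pow (i : Fin θ) (k m : ℕ) :
    (W.convDer i ^ k) (W.x i ^ m) = if m = k then qFactorial (W.χ i (W.g i) : K) k else 0 := by
  induction k generalizing m with
  | zero =>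
    rw [pow_zero]
    change Coalgebra.counit (R := K) (W.x i ^ m) = _
    rw [Bialgebra.counit_pow, counit_x, qFactorial_zero, zero_pow_eq]
  | succ k ih =>
    cases m with
    | zero =>
      rw [pow_zero, convPow_apply_one, convDer_one, zero_pow k.succ_ne_zero,
        if_neg k.succ_ne_zero.symm]
    | succ m =>
      rw [pow_succ (W.x i), ← translateRight_apply, translateRight_x_convDer_pow_succ,
        convSmul_apply, W.mul_convChar_apply _ _ (pow_mem (W.x_mem_nichols i) m), ih, mul_ite,
        mul_zero, qFactorial_succ, mul_comm]
      simp only [Nat.add_right_cancel_iff]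

theorem convDer_pow_mono_of_ne {i j : Fin θ} (hj : j ≠ i) (k : ℕ) {n : Fin θ → ℕ}
    (hn : n j ≠ 0) : (W.convDer i ^ k) (W.mono n) = 0 := by
  have split_off : n - Pi.single j 1 + Pi.single j 1 = n := tsub_add_cancel_of_le fun l => by
    obtain rfl | hl := eq_or_ne l j
    · rw [Pi.single_eq_same]
      exact Nat.one_le_iff_ne_zero.2 hn
    · rw [Pi.single_eq_of_ne hl]
      exact Nat.zero_le _
  obtain ⟨c, hc⟩ := W.exists_mono_mul_x (n - Pi.single j 1) j
  rw [split_off, ← Units.smul_def, ← inv_smul_eq_iff] at hc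
  rw [← hc, Units.smul_def, map_smul, ← translateRight_apply,
    W.translateRight_x_convDer_pow_of_ne hj]
  exact smul_zero _

theorem convDer_pow_mono (i : Fin θ) (k : ℕ) (n : Fin θ → ℕ) :
    (W.convDer i ^ k) (W.mono n) =
      if n = Pi.single i k then qFactorial (W.χ i (W.g i) : K) k else 0 := by
  by_cases hn : ∃ j, j ≠ i ∧ n j ≠ 0
  · obtain ⟨j, hj, hnj⟩ := hn
    rw [W.convDer_pow_mono_of_ne hj k hnj, if_neg]
    rintro rfl
    exact hnj (Pi.single_eq_of_ne hj _)
  · push Not at hn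
    obtain ⟨m, rfl⟩ : ∃ m, n = Pi.single i m :=
      ⟨n i, funext fun j => by
        obtain rfl | hj := eq_or_ne j i
        · rw [Pi.single_eq_same]
        · rw [hn j hj, Pi.single_eq_of_ne hj]⟩
    rw [mono_single, convDer_pow_x_pow]
    simp only [Pi.single_inj]

end QuantumLinearSpace

namespace QuantumLinearSpace

open WithConv

variable {K : Type*} [Field K] {Γ : Type*} [CommGroup Γ] {θ : ℕ} (W : QuantumLinearSpace K Γ θ)

/-! ### The forms `η_i` -/

theorem translateLeft_grp_convChar (h : Γ) (i : Fin θ) :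
    translateLeft (W.grp h) (W.convChar i) = (W.χ i h : K) • W.convChar i :=
  ofConv_injective <| LinearMap.ext fun y => show W.char i (W.grp h * y) =
    (W.χ i h : K) * W.char i y by rw [map_mul, char_grp]

theorem translateLeft_grp_convDer (h : Γ) (i : Fin θ) :
    translateLeft (W.grp h) (W.convDer i) = (W.χ i h : K) • W.convDer i :=
  ofConv_injective <| LinearMap.ext fun y => show W.der i (W.grp h * y) =
    (W.χ i h : K) * W.der i y by rw [der_mul, der_grp, char_grp, zero_mul, zero_add]

theorem translateLeft_grp_convDer_pow (h : Γ) (i : Fin θ) (n : ℕ) :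
    translateLeft (W.grp h) (W.convDer i ^ n) = (W.χ i h : K) ^ n • W.convDer i ^ n := by
  rw [translateLeft_pow (W.isGroupLikeElem_grp h), translateLeft_grp_convDer, smul_pow]

theorem convDer_pow_eq_zero (i : Fin θ) {n : ℕ} (hn : W.r i ≤ n) : W.convDer i ^ n = 0 := by
  rw [← Nat.add_sub_of_le hn, pow_add, convDer_pow_r, zero_mul]

/-- The form `∂_i ^ k χ_i ^ (r_i - k)` on `A`, the left factor of the `k`-th summand of `η_i`. -/
def etaLeft (i : Fin θ) (k : ℕ) : WithConv (W.A →ₗ[K] K) :=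
  W.convDer i ^ k * W.convChar i ^ (W.r i - k)

theorem translateLeft_grp_etaLeft {i : Fin θ} (hχ : W.χ i ^ W.r i = 1) {k : ℕ} (hk : k ≤ W.r i)
    (h : Γ) : translateLeft (W.grp h) (W.etaLeft i k) = W.etaLeft i k := by
  have scalar : (W.χ i h : K) ^ k * (W.χ i h : K) ^ (W.r i - k) = 1 := by
    rw [← pow_add, Nat.add_sub_of_le hk, ← Units.val_pow_eq_pow_val, ← MonoidHom.pow_apply, hχ,
      MonoidHom.one_apply, Units.val_one]
  have group_like := W.isGroupLikeElem_grp h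
  rw [etaLeft, translateLeft_mul group_like, translateLeft_grp_convDer_pow,
    translateLeft_pow group_like, translateLeft_grp_convChar, smul_pow, smul_mul_smul_comm, scalar,
    one_smul]

theorem translateRight_grp_etaLeft (h : Γ) (i : Fin θ) (k : ℕ) :
    translateRight (W.grp h) (W.etaLeft i k) =
      (W.χ i h : K) ^ (W.r i - k) • W.etaLeft i k := by
  rw [etaLeft, translateRight_grp_mul, translateRight_grp_convDer_pow,
    translateRight_pow (W.isGroupLikeElem_grp h), translateRight_grp_convChar, smul_pow,
    mul_smul_comm]

theorem etaLeft_mul_etaLeft (i : Fin θ) {k l : ℕ} (hkl : W.r i ≤ k + l) :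
    W.etaLeft i k * W.etaLeft i l = 0 := by
  have swap := ((W.convChar_mul_convDer i).pow_left (W.r i - k)).pow_right l
  rw [etaLeft, etaLeft, mul_assoc, ← mul_assoc (W.convChar i ^ _), swap, smul_mul_assoc,
    mul_smul_comm, mul_assoc, ← mul_assoc, ← pow_add, W.convDer_pow_eq_zero i hkl, zero_mul,
    smul_zero]

/-- The form `η_i = ∑_{0 < k < r_i} (∂_i ^ k χ_i ^ (r_i - k) ⊗ ∂_i ^ (r_i - k)) / (k)! (r_i - k)!`
on `A ⊗ A`, with `q`-factorials for `q = χ_i(g_i)`. It is the part of `γ_i` linear in `a_i`. -/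
def eta (i : Fin θ) : WithConv (W.A ⊗[K] W.A →ₗ[K] K) :=
  ∑ k ∈ Finset.Ioo 0 (W.r i),
    (qFactorial (W.χ i (W.g i) : K) k * qFactorial (W.χ i (W.g i) : K) (W.r i - k))⁻¹ •
      convBox (W.etaLeft i k) (W.convDer i ^ (W.r i - k))

theorem eta_tmul (i : Fin θ) (y z : W.A) :
    W.eta i (y ⊗ₜ z) = ∑ k ∈ Finset.Ioo 0 (W.r i),
      (qFactorial (W.χ i (W.g i) : K) k * qFactorial (W.χ i (W.g i) : K) (W.r i - k))⁻¹ *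
        (W.etaLeft i k y * (W.convDer i ^ (W.r i - k)) z) := by
  rw [eta, ofConv_sum, LinearMap.sum_apply]
  rfl

theorem eta_mono (i : Fin θ) (n m : Fin θ → ℕ) :
    W.eta i (W.mono n ⊗ₜ W.mono m) = ∑ k ∈ Finset.Ioo 0 (W.r i),
      if n = Pi.single i k ∧ m = Pi.single i (W.r i - k) then 1 else 0 := by
  rw [eta_tmul]
  refine Finset.sum_congr rfl fun k hk => ?_
  obtain ⟨hk0, hkr⟩ := Finset.mem_Ioo.1 hk
  have left_ne_zero := qFactorial_ne_zero (W.isPrimitiveRoot i) hkr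
  have right_ne_zero := qFactorial_ne_zero (W.isPrimitiveRoot i) (Nat.sub_lt_self hk0 hkr.le)
  rw [etaLeft, W.mul_convChar_pow_apply _ _ _ (W.mono_mem_nichols n), convDer_pow_mono,
    convDer_pow_mono, ite_zero_mul_ite_zero, mul_ite, mul_zero,
    inv_mul_cancel₀ (mul_ne_zero left_ne_zero right_ne_zero)]

theorem eta_mono_single {i : Fin θ} {k : ℕ} (h0 : 0 < k) (hk : k < W.r i) :
    W.eta i (W.mono (Pi.single i k) ⊗ₜ W.mono (Pi.single i (W.r i - k))) = 1 := by
  rw [eta_mono, Finset.sum_eq_single k (fun l _ hl => if_neg fun h =>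
    hl (Pi.single_injective i h.1).symm) fun h => absurd (Finset.mem_Ioo.2 ⟨h0, hk⟩) h,
    if_pos ⟨rfl, rfl⟩]

theorem eta_mul_eta (i : Fin θ) : W.eta i * W.eta i = 0 := by
  rw [eta, Finset.sum_mul_sum]
  refine Finset.sum_eq_zero fun k _ => Finset.sum_eq_zero fun l _ => ?_
  rw [smul_mul_smul_comm, convBox_mul_convBox, ← pow_add]
  obtain hkl | hkl := le_total (W.r i) (k + l)
  · rw [W.etaLeft_mul_etaLeft i hkl, convBox_zero_left, smul_zero]
  · rw [W.convDer_pow_eq_zero i (by omega : W.r i ≤ W.r i - k + (W.r i - l)), convBox_zero_right,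
      smul_zero]

theorem eta_mem_weightSpace (i : Fin θ) :
    W.eta i ∈ weightSpace (convBox W.convProj W.convProj)
      (MonoidAlgebra.of K Γ (W.g i ^ W.r i)) := by
  refine Submodule.sum_mem _ fun k hk => Submodule.smul_mem _ _ ?_
  have left_mem := mul_mem_weightSpace (pow_mem_weightSpace (W.convDer_mem_weightSpace i) k)
    (pow_mem_weightSpace (W.convChar_mem_weightSpace i) (W.r i - k))
  have box_mem := convBox_mem_weightSpace left_mem
    (pow_mem_weightSpace (W.convDer_mem_weightSpace i) (W.r i - k))
  rwa [one_pow, mul_one, ← pow_add, Nat.add_sub_of_le (Finset.mem_Ioo.1 hk).2.le, ← map_pow]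
    at box_mem

theorem eta_grp_mul_tmul {i : Fin θ} (hχ : W.χ i ^ W.r i = 1) (h : Γ) (y z : W.A) :
    W.eta i ((W.grp h * y) ⊗ₜ z) = W.eta i (y ⊗ₜ z) := by
  rw [eta_tmul, eta_tmul]
  refine Finset.sum_congr rfl fun k hk => ?_
  rw [← translateLeft_apply, W.translateLeft_grp_etaLeft hχ (Finset.mem_Ioo.1 hk).2.le]

theorem eta_tmul_mul_grp (i : Fin θ) (h : Γ) (y z : W.A) :
    W.eta i (y ⊗ₜ (z * W.grp h)) = W.eta i (y ⊗ₜ z) := by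
  rw [eta_tmul, eta_tmul]
  refine Finset.sum_congr rfl fun k _ => ?_
  rw [← translateRight_apply, translateRight_grp_convDer_pow]

theorem eta_mul_grp_tmul (i : Fin θ) (h : Γ) (y z : W.A) :
    W.eta i ((y * W.grp h) ⊗ₜ z) = W.eta i (y ⊗ₜ (W.grp h * z)) := by
  rw [eta_tmul, eta_tmul]
  refine Finset.sum_congr rfl fun k _ => ?_
  rw [← translateRight_apply, translateRight_grp_etaLeft, ← translateLeft_apply,
    translateLeft_grp_convDer_pow, convSmul_apply, convSmul_apply, mul_left_comm (W.etaLeft i k y),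
    mul_assoc]

/-! ### The maps `γ_i` -/

section ExtendLinearly

variable {W} {γ : W.A ⊗[K] W.A →ₗ[K] K}

theorem map_incl_mul_tmul (hγ : ∀ h y z, γ ((W.grp h * y) ⊗ₜ z) = γ (y ⊗ₜ z))
    (p : MonoidAlgebra K Γ) (y z : W.A) :
    γ ((W.incl p * y) ⊗ₜ z) = Coalgebra.counit (R := K) p * γ (y ⊗ₜ z) := by
  induction p using MonoidAlgebra.induction_on with
  | of h => rw [incl_of, hγ, MonoidAlgebra.of_apply, MonoidAlgebra.counit_single,
      CommSemiring.counit_apply, one_mul]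
  | add p q hp hq => rw [map_add, add_mul, TensorProduct.add_tmul, map_add, hp, hq, map_add,
      add_mul]
  | smul c p hp => rw [map_smul, smul_mul_assoc, ← TensorProduct.smul_tmul', map_smul, hp,
      map_smul, smul_mul_assoc]

theorem map_tmul_mul_incl (hγ : ∀ h y z, γ (y ⊗ₜ (z * W.grp h)) = γ (y ⊗ₜ z))
    (p : MonoidAlgebra K Γ) (y z : W.A) :
    γ (y ⊗ₜ (z * W.incl p)) = γ (y ⊗ₜ z) * Coalgebra.counit (R := K) p := by
  induction p using MonoidAlgebra.induction_on with
  | of h => rw [incl_of, hγ, MonoidAlgebra.of_apply, MonoidAlgebra.counit_single,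
      CommSemiring.counit_apply, mul_one]
  | add p q hp hq => rw [map_add, mul_add, TensorProduct.tmul_add, map_add, hp, hq, map_add,
      mul_add]
  | smul c p hp => rw [map_smul, mul_smul_comm, TensorProduct.tmul_smul, map_smul, hp, map_smul,
      mul_smul_comm]

theorem map_mul_incl_tmul (hγ : ∀ h y z, γ ((y * W.grp h) ⊗ₜ z) = γ (y ⊗ₜ (W.grp h * z)))
    (p : MonoidAlgebra K Γ) (y z : W.A) :
    γ ((y * W.incl p) ⊗ₜ z) = γ (y ⊗ₜ (W.incl p * z)) := by
  induction p using MonoidAlgebra.induction_on with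
  | of h => rw [incl_of, hγ]
  | add p q hp hq => rw [map_add, mul_add, add_mul, TensorProduct.tmul_add, TensorProduct.add_tmul,
      map_add, map_add, hp, hq]
  | smul c p hp => rw [map_smul, mul_smul_comm, smul_mul_assoc, TensorProduct.tmul_smul,
      ← TensorProduct.smul_tmul', map_smul, map_smul, hp]

end ExtendLinearly

theorem one_add_smul_eta_tmul (i : Fin θ) (a : K) (y z : W.A) :
    (1 + a • W.eta i) (y ⊗ₜ z) =
      Coalgebra.counit (R := K) y * Coalgebra.counit (R := K) z + a * W.eta i (y ⊗ₜ z) :=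
  congrArg (· + a * W.eta i (y ⊗ₜ z)) (mul_comm _ _)

theorem counit_x_pow (i : Fin θ) {k : ℕ} (hk : 0 < k) :
    Coalgebra.counit (R := K) (W.x i ^ k) = 0 := by
  rw [Bialgebra.counit_pow, counit_x, zero_pow hk.ne']

theorem isGamma_one_add_smul_eta {i : Fin θ} (hχ : W.χ i ^ W.r i = 1) (a : K) :
    W.IsGamma i a (1 + a • W.eta i).ofConv where
  left := map_incl_mul_tmul fun h y z => by
    rw [one_add_smul_eta_tmul, one_add_smul_eta_tmul, W.eta_grp_mul_tmul hχ, Bialgebra.counit_mul,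
      counit_grp, one_mul]
  right := map_tmul_mul_incl fun h y z => by
    rw [one_add_smul_eta_tmul, one_add_smul_eta_tmul, eta_tmul_mul_grp, Bialgebra.counit_mul,
      counit_grp, mul_one]
  balanced := map_mul_incl_tmul fun h y z => by
    rw [one_add_smul_eta_tmul, one_add_smul_eta_tmul, eta_mul_grp_tmul, Bialgebra.counit_mul,
      Bialgebra.counit_mul, counit_grp, mul_one, one_mul]
  exceptional k h0 hk := by
    rw [one_add_smul_eta_tmul, W.counit_x_pow i h0, zero_mul, zero_add, ← mono_single,
      ← mono_single, W.eta_mono_single h0 hk, mul_one]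
  trivial n m _ _ hnm := by
    rw [one_add_smul_eta_tmul, eta_mono, Finset.sum_eq_zero, mul_zero, add_zero]
    intro k hk
    obtain ⟨h0, hkr⟩ := Finset.mem_Ioo.1 hk
    exact if_neg fun h => hnm ⟨k, h0, hkr, h⟩

theorem exists_qCommute_grp_mono (h : Γ) (n : Fin θ → ℕ) :
    ∃ c : K, QCommute c (W.grp h) (W.mono n) := by
  refine QCommute.exists_list_prod_right fun y hy => ?_
  obtain ⟨i, rfl⟩ := List.mem_ofFn.1 hy
  exact ⟨_, (W.grp_mul_x h i).pow_right (n i)⟩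

namespace IsGamma

variable {W} {i : Fin θ} {a : K} {γ γ' : W.A ⊗[K] W.A →ₗ[K] K}

theorem mono_tmul_mono_eq (hγ : W.IsGamma i a γ) (hγ' : W.IsGamma i a γ') {n m : Fin θ → ℕ}
    (hn : ∀ j, n j < W.r j) (hm : ∀ j, m j < W.r j) :
    γ (W.mono n ⊗ₜ W.mono m) = γ' (W.mono n ⊗ₜ W.mono m) := by
  by_cases h : ∃ k, 0 < k ∧ k < W.r i ∧ n = Pi.single i k ∧ m = Pi.single i (W.r i - k)
  · obtain ⟨k, h0, hk, rfl, rfl⟩ := h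
    rw [mono_single, mono_single, hγ.exceptional k h0 hk, hγ'.exceptional k h0 hk]
  · rw [hγ.trivial n m hn hm h, hγ'.trivial n m hn hm h]

theorem mul_grp_tmul_mul_grp (hγ : W.IsGamma i a γ) {h k : Γ} {c : K} {y z : W.A}
    (hc : QCommute c (W.grp h) z) :
    γ ((y * W.grp h) ⊗ₜ (z * W.grp k)) = c * γ (y ⊗ₜ z) := by
  rw [← incl_of, ← incl_of, hγ.right, hγ.balanced, incl_of, hc, TensorProduct.tmul_smul, map_smul,
    ← incl_of, hγ.right, MonoidAlgebra.of_apply, MonoidAlgebra.of_apply,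
    MonoidAlgebra.counit_single, MonoidAlgebra.counit_single, CommSemiring.counit_apply, mul_one,
    mul_one, smul_eq_mul]

theorem unique (hγ : W.IsGamma i a γ) (hγ' : W.IsGamma i a γ') : γ = γ' := by
  refine TensorProduct.ext (LinearMap.ext_on W.span_reducedMonomials ?_)
  rintro _ ⟨n, hn, h, rfl⟩
  refine LinearMap.ext_on W.span_reducedMonomials ?_
  rintro _ ⟨m, hm, k, rfl⟩
  obtain ⟨c, hc⟩ := W.exists_qCommute_grp_mono h m
  change γ ((W.mono n * W.grp h) ⊗ₜ (W.mono m * W.grp k)) =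
    γ' ((W.mono n * W.grp h) ⊗ₜ (W.mono m * W.grp k))
  rw [hγ.mul_grp_tmul_mul_grp hc, hγ'.mul_grp_tmul_mul_grp hc, hγ.mono_tmul_mono_eq hγ' hn hm]

end IsGamma

theorem gamma_eq {i : Fin θ} (hχ : W.χ i ^ W.r i = 1) (a : K) :
    W.gamma i a = 1 + a • W.eta i := by
  have exists_gamma : ∃ γ, W.IsGamma i a γ := ⟨_, W.isGamma_one_add_smul_eta hχ a⟩
  rw [gamma, dif_pos exists_gamma]
  exact ofConv_injective (exists_gamma.choose_spec.unique (W.isGamma_one_add_smul_eta hχ a))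

theorem alpha_eq {a : Fin θ → K} {I : Finset (Fin θ)} (hχ : ∀ i ∈ I, W.χ i ^ W.r i = 1) :
    W.alpha a I = ((I.sort (· ≤ ·)).map fun i => 1 + a i • W.eta i).prod :=
  congrArg List.prod <| List.map_congr_left fun i hi =>
    W.gamma_eq (hχ i ((Finset.mem_sort _).1 hi)) (a i)

end QuantumLinearSpace

/-! ### Products of square-zero perturbations of the identity -/

theorem prod_map_one_add_mul_prod_reverse_map_one_sub {R ι : Type*} [Ring R] {e : ι → R}
    (he : ∀ i, e i * e i = 0) (l : List ι) :
    (l.map fun i => 1 + e i).prod * (l.reverse.map fun i => 1 - e i).prod = 1 := by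
  induction l with
  | nil => exact mul_one 1
  | cons i l ih =>
    have cancel : (1 + e i) * (1 - e i) = 1 := by
      rw [mul_sub, add_mul, add_mul, he, one_mul, mul_one, one_mul, add_zero, add_sub_cancel_right]
    rw [List.map_cons, List.prod_cons, List.reverse_cons, List.map_append, List.prod_append,
      List.map_singleton, List.prod_singleton, mul_assoc, ← mul_assoc _ _ (1 - e i), ih, one_mul,
      cancel]

theorem prod_reverse_map_one_sub_mul_prod_map_one_add {R ι : Type*} [Ring R] {e : ι → R}
    (he : ∀ i, e i * e i = 0) (l : List ι) :
    (l.reverse.map fun i => 1 - e i).prod * (l.map fun i => 1 + e i).prod = 1 := by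
  have neg_sq (i : ι) : -e i * -e i = 0 := by rw [neg_mul_neg, he]
  simpa only [List.reverse_reverse, sub_neg_eq_add, ← sub_eq_add_neg] using
    prod_map_one_add_mul_prod_reverse_map_one_sub neg_sq l.reverse

theorem prod_map_one_sub_sub_one_mem {R C B ι : Type*} [CommRing R] [AddCommMonoid C] [Module R C]
    [Coalgebra R C] [CommSemiring B] [Algebra R B] [DecidableEq ι] {P : WithConv (C →ₗ[R] B)}
    {b : ι → B} {e : ι → WithConv (C →ₗ[R] R)} (he : ∀ i, e i ∈ weightSpace P (b i))
    {l : List ι} (hl : l.Nodup) {N : Submodule R (WithConv (C →ₗ[R] R))}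
    (hN : ∀ J ⊆ l.toFinset, J.Nonempty → weightSpace P (∏ j ∈ J, b j) ≤ N) :
    (l.map fun i => 1 - e i).prod - 1 ∈ N := by
  induction l generalizing N with
  | nil => simp only [List.map_nil, List.prod_nil, sub_self, zero_mem]
  | cons i l ih =>
    obtain ⟨hi, hl⟩ := List.nodup_cons.1 hl
    rw [List.toFinset_cons] at hN
    set p := (l.map fun j => 1 - e j).prod with hp
    have tail_mem : p - 1 ∈ N := ih hl fun J hJ => hN J (hJ.trans (Finset.subset_insert i _))
    have head_mem : e i ∈ N := by
      refine hN {i} ?_ (Finset.singleton_nonempty i) ?_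
      · exact Finset.singleton_subset_iff.2 (Finset.mem_insert_self i _)
      · rw [Finset.prod_singleton]
        exact he i
    have mul_mem : p - 1 ∈ N.comap (LinearMap.mulLeft R (e i)) := by
      refine ih hl fun J hJ _ φ hφ => hN (insert i J) (Finset.insert_subset_insert i hJ)
        (Finset.insert_nonempty i J) ?_
      rw [Finset.prod_insert fun hiJ => hi (List.mem_toFinset.1 (hJ hiJ))]
      exact mul_mem_weightSpace (he i) hφ
    have expand : (1 - e i) * p - 1 = p - 1 - e i * (p - 1) - e i := by
      rw [sub_mul, one_mul, mul_sub, mul_one]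
      abel
    rw [List.map_cons, List.prod_cons, ← hp, expand]
    exact sub_mem (sub_mem tail_mem mul_mem) head_mem

/-! ### The twist -/

namespace QuantumLinearSpace

open WithConv

section Integral

variable {K Γ : Type*} [Field K] [CommGroup Γ]

theorem integral_of_mul_algebraMap (k : Γ) (c : K) :
    integral K Γ (MonoidAlgebra.of K Γ k * algebraMap K _ c) =
      integral K Γ (MonoidAlgebra.of K Γ k) * c := by
  rw [← Algebra.commutes, ← Algebra.smul_def, map_smul, smul_eq_mul, mul_comm]

theorem integral_of_of_ne_one {k : Γ} (hk : k ≠ 1) :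
    integral K Γ (MonoidAlgebra.of K Γ k) = 0 :=
  Finsupp.single_eq_of_ne hk.symm

theorem integral_algebraMap (c : K) : integral K Γ (algebraMap K _ c) = c :=
  Finsupp.single_eq_same

end Integral

variable {K : Type*} [Field K] {Γ : Type*} [CommGroup Γ] {θ : ℕ} (W : QuantumLinearSpace K Γ θ)

theorem convScalar_mul_convBox_convProj_apply (ψ : WithConv (W.A ⊗[K] W.A →ₗ[K] K)) {y z : W.A}
    (hy : y ∈ W.nichols) (hz : z ∈ W.nichols) :
    (convScalar (MonoidAlgebra K Γ) ψ * convBox W.convProj W.convProj) (y ⊗ₜ z) =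
      algebraMap K _ (ψ (y ⊗ₜ z)) :=
  mul_apply_of_mem_coinvariants (tmul_mem_coinvariants
    (W.nichols_le_coinvariants W.proj_x hy) (W.nichols_le_coinvariants W.proj_x hz)) _

/-- The linear form `λ ∘ π ∘ m` on `A ⊗ A`, in the convolution algebra. -/
def convIntegral : WithConv (W.A ⊗[K] W.A →ₗ[K] K) :=
  toConv (integral K Γ ∘ₗ (convBox W.convProj W.convProj).ofConv)

theorem integral_comp_twistedMul (α : WithConv (W.A ⊗[K] W.A →ₗ[K] K)) :
    integral K Γ ∘ₗ W.proj.toLinearMap ∘ₗ W.twistedMul α =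
      (α * W.convIntegral * Ring.inverse α).ofConv := by
  have on_mul : toConv ((integral K Γ ∘ₗ W.proj.toLinearMap) ∘ₗ LinearMap.mul' K W.A) =
      W.convIntegral :=
    ofConv_injective (TensorProduct.ext' fun y z => congrArg (integral K Γ) (map_mul W.proj y z))
  have pull_out := comp_mul_convScalar (integral K Γ ∘ₗ W.proj.toLinearMap) (Ring.inverse α)
    (convScalar W.A α * toConv (LinearMap.mul' K W.A))
  rw [comp_convScalar_mul, ofConv_toConv, on_mul] at pull_out
  exact congrArg ofConv pull_out

theorem mul_convIntegral_apply (ψ : WithConv (W.A ⊗[K] W.A →ₗ[K] K)) {y z : W.A}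
    (hy : y ∈ W.nichols) (hz : z ∈ W.nichols) :
    (ψ * W.convIntegral) (y ⊗ₜ z) = ψ (y ⊗ₜ z) := by
  rw [convIntegral, ← comp_convScalar_mul]
  refine (congrArg (integral K Γ) (W.convScalar_mul_convBox_convProj_apply ψ hy hz)).trans ?_
  exact integral_algebraMap _

theorem mul_convIntegral_mul_apply (ψ : WithConv (W.A ⊗[K] W.A →ₗ[K] K))
    {φ : WithConv (W.A ⊗[K] W.A →ₗ[K] K)} {k : Γ} (hk : k ≠ 1)
    (hφ : φ ∈ weightSpace (convBox W.convProj W.convProj) (MonoidAlgebra.of K Γ k)) {y z : W.A}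
    (hy : y ∈ W.nichols) (hz : z ∈ W.nichols) :
    (ψ * W.convIntegral * φ) (y ⊗ₜ z) = 0 := by
  have move_left : convScalar (MonoidAlgebra K Γ) ψ * convBox W.convProj W.convProj *
      convScalar _ φ = MonoidAlgebra.of K Γ k •
        (convScalar (MonoidAlgebra K Γ) (ψ * φ) * convBox W.convProj W.convProj) := by
    rw [mul_assoc, mem_weightSpace.1 hφ, mul_smul_comm, convScalar_mul, mul_assoc]
  rw [convIntegral, ← comp_convScalar_mul, ← comp_mul_convScalar, ofConv_toConv, move_left]
  refine (congrArg (fun p => integral K Γ (MonoidAlgebra.of K Γ k * p))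
    (W.convScalar_mul_convBox_convProj_apply (ψ * φ) hy hz)).trans ?_
  rw [integral_of_mul_algebraMap, integral_of_of_ne_one hk, zero_mul]

theorem smul_eta_mul_smul_eta (i : Fin θ) (c : K) : c • W.eta i * c • W.eta i = 0 := by
  rw [smul_mul_smul_comm, eta_mul_eta, smul_zero]

theorem mul_convIntegral_mul_prod_apply (ψ : WithConv (W.A ⊗[K] W.A →ₗ[K] K)) (a : Fin θ → K)
    {l : List (Fin θ)} (hl : l.Nodup)
    (hg : ∀ J ⊆ l.toFinset, J.Nonempty → ∏ j ∈ J, W.g j ^ W.r j ≠ 1) {y z : W.A}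
    (hy : y ∈ W.nichols) (hz : z ∈ W.nichols) :
    (ψ * W.convIntegral * (l.map fun i => 1 - a i • W.eta i).prod) (y ⊗ₜ z) = ψ (y ⊗ₜ z) := by
  let evalMul : WithConv (W.A ⊗[K] W.A →ₗ[K] K) →ₗ[K] K :=
    LinearMap.applyₗ (y ⊗ₜ z) ∘ₗ (WithConv.linearEquiv K (W.A ⊗[K] W.A →ₗ[K] K)).toLinearMap ∘ₗ
      LinearMap.mulLeft K (ψ * W.convIntegral)
  have sub_one_mem : (l.map fun i => 1 - a i • W.eta i).prod - 1 ∈ LinearMap.ker evalMul := by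
    refine prod_map_one_sub_sub_one_mem
      (fun i => Submodule.smul_mem _ (a i) (W.eta_mem_weightSpace i)) hl fun J hJ hJ0 φ hφ => ?_
    rw [← map_prod] at hφ
    exact W.mul_convIntegral_mul_apply ψ (hg J hJ hJ0) hφ hy hz
  rw [LinearMap.mem_ker, map_sub, sub_eq_zero] at sub_one_mem
  refine sub_one_mem.trans ?_
  change (ψ * W.convIntegral * 1) (y ⊗ₜ z) = _
  rw [mul_one, W.mul_convIntegral_apply ψ hy hz]

variable {W} {a : Fin θ → K} {I : Finset (Fin θ)}

theorem alpha_mul_prod (hχ : ∀ i ∈ I, W.χ i ^ W.r i = 1) :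
    W.alpha a I * ((I.sort (· ≤ ·)).reverse.map fun i => 1 - a i • W.eta i).prod = 1 := by
  rw [W.alpha_eq hχ]
  exact prod_map_one_add_mul_prod_reverse_map_one_sub
    (fun i => W.smul_eta_mul_smul_eta i (a i)) _

theorem prod_mul_alpha (hχ : ∀ i ∈ I, W.χ i ^ W.r i = 1) :
    ((I.sort (· ≤ ·)).reverse.map fun i => 1 - a i • W.eta i).prod * W.alpha a I = 1 := by
  rw [W.alpha_eq hχ]
  exact prod_reverse_map_one_sub_mul_prod_map_one_add
    (fun i => W.smul_eta_mul_smul_eta i (a i)) _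

theorem isUnit_alpha (hχ : ∀ i ∈ I, W.χ i ^ W.r i = 1) : IsUnit (W.alpha a I) :=
  ⟨⟨_, _, alpha_mul_prod hχ, prod_mul_alpha hχ⟩, rfl⟩

theorem inverse_alpha (hχ : ∀ i ∈ I, W.χ i ^ W.r i = 1) :
    Ring.inverse (W.alpha a I) =
      ((I.sort (· ≤ ·)).reverse.map fun i => 1 - a i • W.eta i).prod :=
  Ring.inverse_unit ⟨_, _, alpha_mul_prod hχ, prod_mul_alpha hχ⟩

end QuantumLinearSpace

end

theorem mainTheorem3_general {K : Type*} [Field K] {Γ : Type*} [CommGroup Γ] {θ : ℕ}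
    (W : QuantumLinearSpace K Γ θ) (I : Finset (Fin θ)) (a : Fin θ → K)
    (hχ : ∀ i ∈ I, W.χ i ^ W.r i = 1)
    (hg : ∀ J ⊆ I, J.Nonempty → ∏ j ∈ J, W.g j ^ W.r j ≠ 1) :
    (∀ i ∈ I, W.IsGamma i (a i) (W.gamma i (a i)).ofConv) ∧
    IsUnit (W.alpha a I) ∧
    QuantumLinearSpace.integral K Γ ∘ₗ W.proj.toLinearMap ∘ₗ W.twistedMul (W.alpha a I) ∘ₗ
        W.nicholsIncl =
      (W.alpha a I).ofConv ∘ₗ W.nicholsIncl := by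
  refine ⟨fun i hi => ?_, QuantumLinearSpace.isUnit_alpha hχ,
    TensorProduct.ext' fun y z => ?_⟩
  · rw [W.gamma_eq (hχ i hi)]
    exact W.isGamma_one_add_smul_eta (hχ i hi) (a i)
  · have twisted := W.integral_comp_twistedMul (W.alpha a I)
    rw [QuantumLinearSpace.inverse_alpha hχ] at twisted
    refine (LinearMap.congr_fun twisted (y.1 ⊗ₜ[K] z.1)).trans ?_
    refine W.mul_convIntegral_mul_prod_apply _ a
      (List.nodup_reverse.2 (I.sort_nodup (· ≤ ·))) (fun J hJ => hg J ?_) y.2 z.2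
    rwa [List.toFinset_reverse, Finset.sort_toFinset] at hJ

theorem mainTheorem3 {K : Type*} [Field K] [CharZero K] {Γ : Type*} [CommGroup Γ] [Finite Γ] {θ : ℕ}
    (W : QuantumLinearSpace K Γ θ) (I : Finset (Fin θ)) (a : Fin θ → K)
    (hχ : ∀ i ∈ I, W.χ i ^ W.r i = 1)
    (hγ : ∀ i ∈ I, W.gamma i (a i) ≠ 1)
    (hg : ∀ J ⊆ I, J.Nonempty → ∏ j ∈ J, W.g j ^ W.r j ≠ 1) :
    (∀ i ∈ I, W.IsGamma i (a i) (W.gamma i (a i)).ofConv) ∧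
    IsUnit (W.alpha a I) ∧
    QuantumLinearSpace.integral K Γ ∘ₗ W.proj.toLinearMap ∘ₗ W.twistedMul (W.alpha a I) ∘ₗ
        W.nicholsIncl =
      (W.alpha a I).ofConv ∘ₗ W.nicholsIncl :=
  mainTheorem3_general W I a hχ hg
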